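/- A growth function is a continuous nondecreasing function $\Phi$ from $[0,\infty)$ onto itself. Let $\mathscr U$ be the set of growth functions $\Phi$ such that $t\mapsto \Phi(t)/t$ is nondecreasing on $(0,\infty)$ and, for some real $q\ge 1$ and some $C>0$, $\Phi(st)\le C\,t^{q}\,\Phi(s)$ for all $s>0$ and $t\ge 1$. For measurable $f:\mathbb R\to\mathbb C$ put $$\|f\|_{L^\Phi}=\inf\Big\{\lambda>0:\int_{\mathbb R}\Phi\Big(\frac{|f(x)|}{\lambda}\Big)\,dx\le 1\Big\}\in[0,\infty]\qquad(\inf\emptyset=\infty),$$ and let $L^\Phi(\mathbb R)$ be the set of almost-everywhere equivalence classes of measurable $f$ with $\|f\|_{L^\Phi}<\infty$. Let $\mathbb C_+=\{z\in\mathbb C:\operatorname{Im}z>0\}$. For $F:\mathbb C_+\to\mathbb C$ analytic put $\|F\|_{H^\Phi}=\sup_{y>0}\|F(\cdot+iy)\|_{L^\Phi}$, and let $H^\Phi(\mathbb C_+)$ be the set of analytic functions $F$ on $\mathbb C_+$ with $\|F\|_{H^\Phi}<\infty$. Let $H^\Phi(\mathbb R)$ be the set of $f\in L^\Phi(\mathbb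 R)$ such that, for every $z\in\mathbb C_+$, the integral $\int_{\mathbb R}\frac{f(t)}{t-\overline z}\,dt$ converges absolutely and equals $0$. **Theorem.** Let $\Phi\in\mathscr U$ be convex and let $F$ be an analytic function on $\mathbb C_+$. The following assertions are equivalent: (i) $F\in H^\Phi(\mathbb C_+)$. (ii) There exists $f\in H^\Phi(\mathbb R)$ such that $$F(x+iy)=\frac1\pi\int_{\mathbb R}\frac{y}{(x-t)^2+y^2}f(t)\,dt\qquad\text{for all }x+iy\in\mathbb C_+.$$ If so, $f$ is unique, and for all $z=x+iy\in\mathbb C_+$ $$F(z)=\frac{i}{\pi}\int_{\mathbb R}\frac{x-t}{(x-t)^2+y^2}f(t)\,dt=\frac{1}{2\pi i}\int_{\mathbb R}\frac{f(t)}{t-z}\,dt,$$ where all these integrals converge absolutely. Moreover, $$\lim_{y\to0^+}\|F(\cdot+iy)-f\|_{L^\Phi}=0\qquad\text{and}\qquad\|F\|_{H^\Phi}=\lim_{y\to0^+}\|F(\cdot+iy)\|_{L^\Phi}=\|f\|_{L^\Phi}.$$ -/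

import Mathlib

open MeasureTheory Filter Topology
open scoped NNReal ENNReal

noncomputable section

namespace HardyOrlicz

/-- A growth function: a continuous nondecreasing function from `[0, ∞)` onto itself. -/
structure IsGrowthFunction (Φ : ℝ≥0 → ℝ≥0) : Prop where
  continuous : Continuous Φ
  monotone : Monotone Φ
  surjective : Function.Surjective Φ

/-- `Φ` is of upper type `q`. -/
def IsUpperType (q : ℝ) (Φ : ℝ≥0 → ℝ≥0) : Prop :=
  ∃ C : ℝ≥0, 0 < C ∧ ∀ s : ℝ≥0, 0 < s → ∀ t : ℝ≥0, 1 ≤ t → Φ (s * t) ≤ C * t ^ q * Φ s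

/-- The class `𝒰^q`: growth functions of upper type `q` with `t ↦ Φ(t) / t` nondecreasing
on `(0, ∞)`. -/
structure MemClassUq (q : ℝ) (Φ : ℝ≥0 → ℝ≥0) : Prop where
  growth : IsGrowthFunction Φ
  upperType : IsUpperType q Φ
  monotoneOn_div : MonotoneOn (fun t : ℝ≥0 => Φ t / t) (Set.Ioi 0)

/-- The class `𝒰`, the union of the classes `𝒰^q` over real `q ≥ 1`. -/
def MemClassU (Φ : ℝ≥0 → ℝ≥0) : Prop :=
  ∃ q : ℝ, 1 ≤ q ∧ MemClassUq q Φ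

/-- The Luxemburg (quasi-)norm of `f : ℝ → ℂ`, with value `∞` if no `c` is admissible. -/
def luxNorm (Φ : ℝ≥0 → ℝ≥0) (f : ℝ → ℂ) : ℝ≥0∞ :=
  ⨅ (c : ℝ≥0) (_ : 0 < c) (_ : ∫⁻ x : ℝ, (Φ (‖f x‖₊ / c) : ℝ≥0∞) ≤ 1), (c : ℝ≥0∞)

/-- The Orlicz space `L^Φ(ℝ)`, a set of almost-everywhere classes of measurable functions. -/
def orliczSpace (Φ : ℝ≥0 → ℝ≥0) : Set (ℝ →ₘ[volume] ℂ) :=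
  {f | luxNorm Φ f < ∞}

/-- The open upper half-plane. -/
def upperHalf : Set ℂ := {z | 0 < z.im}

/-- The trace `x ↦ F (x + i y)` of `F` on the horizontal line at height `y`. -/
def slice (F : ℂ → ℂ) (y : ℝ) : ℝ → ℂ := fun x => F (x + y * Complex.I)

/-- The supremum over `y > 0` of the Luxemburg norms of the traces of `F` at height `y`. -/
def hardyNorm (Φ : ℝ≥0 → ℝ≥0) (F : ℂ → ℂ) : ℝ≥0∞ :=
  ⨆ (y : ℝ) (_ : 0 < y), luxNorm Φ (slice F y)

/-- `h^Φ` of the upper half-plane: harmonic functions with finite Hardy–Orlicz norm. -/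
def harmonicHardy (Φ : ℝ≥0 → ℝ≥0) : Set (ℂ → ℂ) :=
  {F | InnerProductSpace.HarmonicOnNhd F upperHalf ∧ hardyNorm Φ F < ∞}

/-- `H^Φ` of the upper half-plane: the analytic members of `h^Φ`. -/
def analyticHardy (Φ : ℝ≥0 → ℝ≥0) : Set (ℂ → ℂ) :=
  {F | F ∈ harmonicHardy Φ ∧ AnalyticOnNhd ℂ F upperHalf}

/-- `H^Φ(ℝ)`: those `f ∈ L^Φ(ℝ)` with `∫ f(t) / (t - z̄) dt = 0` for all `z` in the upper
half-plane, the integrals being absolutely convergent. -/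
def realHardy (Φ : ℝ≥0 → ℝ≥0) : Set (ℝ →ₘ[volume] ℂ) :=
  {f | f ∈ orliczSpace Φ ∧ ∀ z ∈ upperHalf,
    Integrable (fun t : ℝ => f t / ((t : ℂ) - (starRingEnd ℂ) z)) ∧
    ∫ t : ℝ, f t / ((t : ℂ) - (starRingEnd ℂ) z) = 0}

/-- The integrand of the Poisson integral at `z = x + i y`, without the factor `1 / π`. -/
def poissonIntegrand (f : ℝ → ℂ) (z : ℂ) (t : ℝ) : ℂ :=
  ((z.im / ((z.re - t) ^ 2 + z.im ^ 2) : ℝ) : ℂ) * f t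

/-- The integrand of the conjugate Poisson integral at `z`, without the factor `1 / π`. -/
def conjPoissonIntegrand (f : ℝ → ℂ) (z : ℂ) (t : ℝ) : ℂ :=
  (((z.re - t) / ((z.re - t) ^ 2 + z.im ^ 2) : ℝ) : ℂ) * f t

/-- The integrand of the Cauchy integral at `z`, without the factor `1 / (2 π i)`. -/
def cauchyIntegrand (f : ℝ → ℂ) (z : ℂ) (t : ℝ) : ℂ :=
  f t / ((t : ℂ) - z)

/-- `F` is the Poisson integral of `f` on the upper half-plane. -/
def IsPoissonIntegral (F : ℂ → ℂ) (f : ℝ → ℂ) : Prop :=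
  ∀ z ∈ upperHalf, F z = (1 / (Real.pi : ℂ)) * ∫ t : ℝ, poissonIntegrand f z t

end HardyOrlicz

end

/-! The Poisson integral of `f` at `x + iy` is the expectation of `f (x + y * S)` for a standard
Cauchy variable `S` (`poissonAvg`). Jensen's inequality and translation invariance then make Poisson
averaging a contraction of the Luxemburg norm (`luxNorm_poissonAvg_le`), which gives (ii) ⇒ (i).

For (i) ⇒ (ii) the traces of `F` are only bounded in `L¹` of the Cauchy distribution, where a weak
limit could be a singular measure. Analyticity excludes this as in the theorem of F. and M. Riesz:
`|F|^{1/2}` is subharmonic (`sqrt_norm_le_circleAverage`) and its traces are bounded in `L²`, so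
they have a weak limit `g` and `|F(x + iy)|` is at most the squared modulus of the Poisson average
of `g`. Dividing the traces by the Poisson averages of `g`, which converge strongly in `L²`, leaves
factors bounded in `L²`, with a weak limit `b'`. A weakly convergent factor times a strongly
convergent one converges weakly, so the traces tend to the function `f = b' * g` against bounded
continuous test functions (`exists_boundary_function`). Testing with Poisson kernels represents `F`;
testing with products of two Cauchy kernels, and then sending one pole to infinity, gives the
vanishing condition (`exists_poisson_representation`, `integral_cauchy_eq_zero`). The mean value
properties used here need `F` bounded on every `Im z ≥ y₀`, which comes from area means
(`MemClassUq.exists_norm_le`).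

The upper type condition makes all dilated modulars of `f` finite and its Cauchy integrals
absolutely convergent. Truncation then shows that Poisson averages converge to `f` in modular, hence
in norm (`tendsto_modular_poissonAvg_sub`); uniqueness and the norm equalities follow. The conjugate
Poisson and Cauchy formulas are partial fractions of the kernels, in which the `z̄` term integrates
to zero. -/

namespace HardyOrlicz

/-! ### Poisson integrals as averages over the Cauchy distribution. -/

/-- The standard Cauchy distribution, with density `1 / (π (1 + s ^ 2))`. -/
noncomputable abbrev stdCauchy : Measure ℝ := ProbabilityTheory.cauchyMeasure 0 1

/-- The Poisson integral of `f` at `x + i y`, as an average against the Cauchy distribution. -/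
noncomputable def poissonAvg (f : ℝ → ℂ) (y x : ℝ) : ℂ := ∫ s, f (x + y * s) ∂stdCauchy

lemma stdCauchy_eq : stdCauchy =
    volume.withDensity (fun s : ℝ => ENNReal.ofReal (Real.pi⁻¹ * (1 + s ^ 2)⁻¹)) := by
  rw [stdCauchy, ProbabilityTheory.cauchyMeasure_of_scale_ne_zero _ one_ne_zero]
  congr 1
  ext s
  simp [ProbabilityTheory.cauchyPDF, ProbabilityTheory.cauchyPDFReal, add_comm]

lemma density_le_one (s : ℝ) : Real.pi⁻¹ * (1 + s ^ 2)⁻¹ ≤ 1 :=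
  mul_le_one₀ (inv_le_one_of_one_le₀ (by linarith [Real.pi_gt_three])) (by positivity)
    (inv_le_one_of_one_le₀ (by nlinarith [sq_nonneg s]))

lemma stdCauchy_le : stdCauchy ≤ volume := by
  rw [stdCauchy_eq]
  conv_rhs => rw [← withDensity_one (μ := (volume : Measure ℝ))]
  exact withDensity_mono (ae_of_all _ fun s => by
    simpa using density_le_one s)

lemma ac_stdCauchy : (volume : Measure ℝ) ≪ stdCauchy := by
  rw [stdCauchy_eq]
  refine withDensity_absolutelyContinuous' (by fun_prop) (ae_of_all _ fun s => ?_)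
  have : 0 < Real.pi⁻¹ * (1 + s ^ 2)⁻¹ := by positivity
  simpa using this

lemma lintegral_stdCauchy (h : ℝ → ℝ≥0∞) :
    ∫⁻ s, h s ∂stdCauchy = ∫⁻ s, ENNReal.ofReal (Real.pi⁻¹ * (1 + s ^ 2)⁻¹) * h s := by
  rw [stdCauchy_eq, lintegral_withDensity_eq_lintegral_mul_non_measurable _ (by fun_prop)
    (ae_of_all _ fun s => by simp)]
  rfl

lemma integral_stdCauchy {E : Type*} [NormedAddCommGroup E] [NormedSpace ℝ E] (h : ℝ → E) :
    ∫ s, h s ∂stdCauchy = ∫ s, (Real.pi⁻¹ * (1 + s ^ 2)⁻¹) • h s := by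
  rw [stdCauchy_eq, integral_withDensity_eq_integral_toReal_smul (by fun_prop)
    (ae_of_all _ fun s => by simp)]
  congr 1
  ext s
  rw [ENNReal.toReal_ofReal (by positivity)]

lemma integrable_stdCauchy_iff {E : Type*} [NormedAddCommGroup E] [NormedSpace ℝ E] {h : ℝ → E} :
    Integrable h stdCauchy ↔ Integrable (fun s => (Real.pi⁻¹ * (1 + s ^ 2)⁻¹) • h s) := by
  rw [stdCauchy_eq, integrable_withDensity_iff_integrable_smul' (by fun_prop)
    (ae_of_all _ fun s => by simp)]
  refine integrable_congr (ae_of_all _ fun s => ?_)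
  simp only
  rw [ENNReal.toReal_ofReal (by positivity)]

lemma poissonIntegrand_comp {f : ℝ → ℂ} {x y : ℝ} (hy : 0 < y) (s : ℝ) :
    (Real.pi⁻¹ * (1 + s ^ 2)⁻¹) • f (x + y * s) =
      ((Real.pi : ℂ)⁻¹ * y) * poissonIntegrand f (x + y * Complex.I) (x + y * s) := by
  have h1 : (1 + s ^ 2) ≠ 0 := by positivity
  have h2 : (x - (x + y * s)) ^ 2 + y ^ 2 ≠ 0 := by positivity
  have h3 : Real.pi⁻¹ * (1 + s ^ 2)⁻¹ =
      Real.pi⁻¹ * y * (y / ((x - (x + y * s)) ^ 2 + y ^ 2)) := by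
    have : (x - (x + y * s)) ^ 2 + y ^ 2 = y ^ 2 * (1 + s ^ 2) := by ring
    rw [this]
    field_simp
  rw [h3, poissonIntegrand, Complex.real_smul]
  push_cast
  simp
  ring

lemma poissonAvg_eq (f : ℝ → ℂ) {x y : ℝ} (hy : 0 < y) :
    poissonAvg f y x =
      (1 / (Real.pi : ℂ)) * ∫ t : ℝ, poissonIntegrand f (x + y * Complex.I) t := by
  rw [poissonAvg, integral_stdCauchy]
  simp_rw [poissonIntegrand_comp hy]
  rw [integral_const_mul]
  have h1 := Measure.integral_comp_mul_left
    (fun t => poissonIntegrand f (x + y * Complex.I) (x + t)) y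
  rw [h1, integral_add_left_eq_self (fun t => poissonIntegrand f (x + y * Complex.I) t),
    abs_of_pos (by positivity), Complex.real_smul]
  have : (y : ℂ) ≠ 0 := by exact_mod_cast hy.ne'
  push_cast
  field_simp

lemma isPoissonIntegral_iff {F : ℂ → ℂ} {f : ℝ → ℂ} :
    IsPoissonIntegral F f ↔ ∀ y : ℝ, 0 < y → ∀ x, slice F y x = poissonAvg f y x := by
  constructor
  · intro h y hy x
    rw [poissonAvg_eq f hy, slice]
    exact h _ (by simpa [upperHalf] using hy)
  · intro h z hz
    have := h z.im hz z.re
    rw [poissonAvg_eq f hz, slice, Complex.re_add_im] at this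
    exact this

/-- Since `t² ≤ 2(t - x)² + 2x²`, the constant absorbs `1 + 2x²` through the term `y²`. This
compares the Poisson kernel at `x + iy` with the Cauchy density. -/
lemma one_add_sq_le {x y : ℝ} (hy : 0 < y) (t : ℝ) :
    1 + t ^ 2 ≤ ((1 + 2 * x ^ 2) / y ^ 2 + 2) * ((t - x) ^ 2 + y ^ 2) := by
  have h : (1 + 2 * x ^ 2) / y ^ 2 * y ^ 2 = 1 + 2 * x ^ 2 := by field_simp
  have h2 : 0 ≤ (1 + 2 * x ^ 2) / y ^ 2 * (t - x) ^ 2 := by positivity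
  nlinarith [sq_nonneg (t - 2 * x), sq_nonneg y]

lemma integrable_kernel_mul {f : ℝ → ℂ} (hfi : Integrable f stdCauchy) {k : ℝ → ℂ}
    (hk : AEStronglyMeasurable k) {A : ℝ} (hA : ∀ t, ‖k t‖ * (1 + t ^ 2) ≤ A) :
    Integrable (fun t => k t * f t) := by
  rw [integrable_stdCauchy_iff] at hfi
  have h1 : AEStronglyMeasurable (fun t : ℝ => (Real.pi * (1 + t ^ 2) : ℝ) • k t) := by
    exact AEStronglyMeasurable.smul (f := fun t : ℝ => Real.pi * (1 + t ^ 2))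
      (Measurable.aestronglyMeasurable (by fun_prop)) hk
  have := hfi.bdd_mul h1 (c := Real.pi * A) (ae_of_all _ fun t => by
    rw [norm_smul, Real.norm_of_nonneg (by positivity)]
    nlinarith [hA t, Real.pi_pos])
  refine this.congr (ae_of_all _ fun t => ?_)
  have h3 : (1 + (t : ℂ) ^ 2) ≠ 0 := by
    have : (1 + t ^ 2) ≠ 0 := by positivity
    exact_mod_cast this
  have h4 : (Real.pi : ℂ) ≠ 0 := by exact_mod_cast Real.pi_ne_zero
  simp only [Complex.real_smul]
  push_cast
  field_simp

lemma integrable_poissonIntegrand {f : ℝ → ℂ} (hfi : Integrable f stdCauchy) {z : ℂ}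
    (hz : 0 < z.im) : Integrable (poissonIntegrand f z) := by
  refine integrable_kernel_mul hfi (A := z.im * ((1 + 2 * z.re ^ 2) / z.im ^ 2 + 2))
    (Measurable.aestronglyMeasurable (by fun_prop)) fun t => ?_
  have h2 : 0 < (z.re - t) ^ 2 + z.im ^ 2 := by positivity
  rw [Complex.norm_real, Real.norm_of_nonneg (by positivity), div_mul_eq_mul_div, div_le_iff₀ h2,
    mul_assoc]
  refine mul_le_mul_of_nonneg_left ?_ hz.le
  have := one_add_sq_le (x := z.re) hz t
  rwa [show (t - z.re) ^ 2 = (z.re - t) ^ 2 by ring] at this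

lemma integrable_comp_affine {f : ℝ → ℂ} (hfi : Integrable f stdCauchy) (x : ℝ) {y : ℝ}
    (hy : 0 < y) : Integrable (fun s => f (x + y * s)) stdCauchy := by
  rw [integrable_stdCauchy_iff]
  simp_rw [poissonIntegrand_comp hy]
  refine Integrable.const_mul ?_ _
  have h := integrable_poissonIntegrand hfi (z := x + y * Complex.I) (by simpa using hy)
  exact (h.comp_add_left x).comp_mul_left' hy.ne'

lemma stronglyMeasurable_poissonAvg {f : ℝ → ℂ} (hf : Measurable f) (y : ℝ) :
    StronglyMeasurable (poissonAvg f y) := by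
  have : StronglyMeasurable (fun p : ℝ × ℝ => f (p.1 + y * p.2)) :=
    (hf.comp (by fun_prop)).stronglyMeasurable
  exact this.integral_prod_right

/-- Integrate in `x` first: Lebesgue measure is translation invariant and the Cauchy distribution
has mass one. -/
lemma lintegral_lintegral_translate {h : ℝ → ℝ≥0∞} (hh : Measurable h) (y : ℝ) :
    ∫⁻ x, ∫⁻ s, h (x + y * s) ∂stdCauchy = ∫⁻ x, h x := by
  rw [lintegral_lintegral_swap (by fun_prop)]
  simp_rw [lintegral_add_right_eq_self h]
  simp

/-! ### Circle averages, the Cayley transform and mean value properties on the half-plane. -/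

lemma circleMap_two_arctan (r t : ℝ) :
    circleMap 0 r (2 * Real.arctan t) = r * ((1 + Complex.I * t) / (1 - Complex.I * t)) := by
  have h1 : (0 : ℝ) < 1 + t ^ 2 := by positivity
  have hne : (1 - Complex.I * t) ≠ 0 := by
    intro h
    have := congrArg Complex.re h
    simp at this
  have hc := Real.cos_sq_arctan t
  have hs : Real.sin (Real.arctan t) = t * Real.cos (Real.arctan t) := by
    rw [Real.sin_arctan, Real.cos_arctan]; ring
  have key : Complex.exp ((2 * Real.arctan t : ℝ) * Complex.I) =
      (1 + Complex.I * t) / (1 - Complex.I * t) := by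
    rw [eq_div_iff hne, Complex.exp_mul_I, ← Complex.ofReal_cos, ← Complex.ofReal_sin,
      Real.cos_two_mul, Real.sin_two_mul, hs]
    have hc' : (Real.cos (Real.arctan t)) ^ 2 * (1 + t ^ 2) = 1 := by
      rw [hc]; field_simp
    generalize Real.cos (Real.arctan t) = c at hc'
    have hcc : (c : ℂ) ^ 2 * (1 + (t : ℂ) ^ 2) = 1 := by exact_mod_cast hc'
    push_cast
    linear_combination 2 * hcc - 2 * (t : ℂ) ^ 2 * (c : ℂ) ^ 2 * Complex.I_sq
  rw [circleMap, zero_add, key]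

/-- The substitution `θ = 2 arctan t` carries `dθ / 2π` on `(-π, π)` to the Cauchy density. -/
lemma circleAverage_eq_integral_stdCauchy {E : Type*} [NormedAddCommGroup E] [NormedSpace ℝ E]
    (Q : ℂ → E) (r : ℝ) :
    Real.circleAverage Q 0 r =
      ∫ t : ℝ, Q (r * ((1 + Complex.I * t) / (1 - Complex.I * t))) ∂stdCauchy := by
  rw [Real.circleAverage_eq_integral_add (-Real.pi),
    intervalIntegral.integral_comp_add_right (fun θ => Q (circleMap 0 r θ)),
    intervalIntegral.integral_of_le (by linarith [Real.pi_pos]),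
    integral_Ioc_eq_integral_Ioo]
  have himg : (fun t : ℝ => 2 * Real.arctan t) '' Set.univ =
      Set.Ioo (0 + -Real.pi) (2 * Real.pi + -Real.pi) := by
    ext θ
    simp only [Set.image_univ, Set.mem_range, Set.mem_Ioo]
    constructor
    · rintro ⟨t, rfl⟩
      have := Real.neg_pi_div_two_lt_arctan t
      have := Real.arctan_lt_pi_div_two t
      constructor <;> linarith
    · rintro ⟨h1, h2⟩
      exact ⟨Real.tan (θ / 2), by
        rw [Real.arctan_tan (by linarith) (by linarith)]; ring⟩
  rw [← himg, integral_image_eq_integral_abs_deriv_smul MeasurableSet.univ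
    (f' := fun t => 2 * (1 / (1 + t ^ 2)))
    (fun t _ => ((Real.hasDerivAt_arctan t).const_mul 2).hasDerivWithinAt)
    (fun a _ b _ h => Real.arctan_injective (by simpa using h)), integral_stdCauchy,
    ← integral_smul, Measure.restrict_univ]
  congr 1
  ext t
  rw [circleMap_two_arctan, abs_of_pos (by positivity), smul_smul]
  congr 1
  field_simp

/-- The Cayley transform from the unit disc to the upper half-plane. -/
noncomputable def cayley (w : ℂ) : ℂ := Complex.I * ((1 - w) / (1 + w))

lemma cayley_zero : cayley 0 = Complex.I := by simp [cayley]

lemma one_add_ne_zero_of_norm_lt {w : ℂ} (hw : ‖w‖ < 1) : 1 + w ≠ 0 := by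
  intro h
  have : w = -1 := by linear_combination h
  simp [this] at hw

lemma cayley_im (w : ℂ) : (cayley w).im = (1 - ‖w‖ ^ 2) / Complex.normSq (1 + w) := by
  rw [← Complex.normSq_eq_norm_sq, cayley, Complex.I_mul_im, Complex.div_re, ← add_div]
  congr 1
  simp [Complex.normSq_apply]
  ring

lemma cayley_im_pos {w : ℂ} (hw : ‖w‖ < 1) : 0 < (cayley w).im := by
  rw [cayley_im]
  refine div_pos ?_ (Complex.normSq_pos.2 (one_add_ne_zero_of_norm_lt hw))
  nlinarith [norm_nonneg w]

lemma analyticOnNhd_comp_cayley {G : ℂ → ℂ} (hG : AnalyticOnNhd ℂ G upperHalf) :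
    AnalyticOnNhd ℂ (G ∘ cayley) (Metric.ball 0 1) := by
  refine hG.comp (fun w hw => ?_) fun w hw => cayley_im_pos (by simpa using hw)
  have : 1 + w ≠ 0 := one_add_ne_zero_of_norm_lt (by simpa using hw)
  unfold cayley
  fun_prop (disch := assumption)

lemma norm_boundary_point (t : ℝ) : ‖(1 + Complex.I * t) / (1 - Complex.I * t)‖ = 1 := by
  have : (1 - Complex.I * t) = (starRingEnd ℂ) (1 + Complex.I * t) := by simp [sub_eq_add_neg]
  rw [norm_div, this, RCLike.norm_conj, div_self]
  rw [norm_ne_zero_iff]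
  intro h
  have := congrArg Complex.re h
  simp at this

lemma cayley_boundary (t : ℝ) : cayley ((1 + Complex.I * t) / (1 - Complex.I * t)) = t := by
  have hne : (1 - Complex.I * t) ≠ 0 := by
    intro h
    have := congrArg Complex.re h
    simp at this
  rw [cayley]
  have h2 : 1 + (1 + Complex.I * t) / (1 - Complex.I * t) = 2 / (1 - Complex.I * t) := by
    field_simp; ring
  have h3 : 1 - (1 + Complex.I * t) / (1 - Complex.I * t) =
      -2 * Complex.I * t / (1 - Complex.I * t) := by
    field_simp; ring
  rw [h2, h3]
  field_simp
  linear_combination (-(t : ℂ)) * Complex.I_sq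

/-- Averages over circles of radius `r → 1`, transplanted to the half-plane. -/
lemma tendsto_circleAverage_cayley {E : Type*} [NormedAddCommGroup E] [NormedSpace ℝ E]
    {Q : ℂ → E} {B : ℝ} (hQ : ContinuousOn Q {z | 0 ≤ z.im}) (hB : ∀ z, 0 ≤ z.im → ‖Q z‖ ≤ B) :
    Tendsto (fun r => Real.circleAverage (Q ∘ cayley) 0 r) (𝓝[<] 1)
      (𝓝 (∫ t : ℝ, Q t ∂stdCauchy)) := by
  simp_rw [circleAverage_eq_integral_stdCauchy]
  have hr : ∀ᶠ r : ℝ in 𝓝[<] 1, r ∈ Set.Ioo (0 : ℝ) 1 := Ioo_mem_nhdsLT one_pos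
  have hlt : ∀ {r : ℝ}, r ∈ Set.Ioo (0 : ℝ) 1 → ∀ t : ℝ,
      ‖(r : ℂ) * ((1 + Complex.I * t) / (1 - Complex.I * t))‖ < 1 := by
    intro r hr t
    rw [norm_mul, norm_boundary_point, mul_one, Complex.norm_real, Real.norm_of_nonneg hr.1.le]
    exact hr.2
  have hden : ∀ t : ℝ, (1 - Complex.I * t) ≠ 0 := by
    intro t h
    have := congrArg Complex.re h
    simp at this
  refine tendsto_integral_filter_of_dominated_convergence (fun _ => B) ?_ ?_
    (integrable_const _) (ae_of_all _ fun t => ?_)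
  · filter_upwards [hr] with r hr
    refine Continuous.aestronglyMeasurable ?_
    refine hQ.comp_continuous ?_ fun t => (cayley_im_pos (hlt hr t)).le
    unfold cayley
    have : ∀ t : ℝ, 1 + (r : ℂ) * ((1 + Complex.I * t) / (1 - Complex.I * t)) ≠ 0 :=
      fun t => one_add_ne_zero_of_norm_lt (hlt hr t)
    fun_prop (disch := first | assumption | exact hden _ | exact this _)
  · filter_upwards [hr] with r hr
    exact ae_of_all _ fun t => hB _ (cayley_im_pos (hlt hr t)).le
  · have hQt : ContinuousWithinAt Q {z | 0 ≤ z.im} (t : ℂ) := hQ _ (by simp)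
    -- The pole `-1` of the Cayley transform corresponds to `t = ∞`, so no real `t` reaches it.
    have hne : 1 + (1 + Complex.I * t) / (1 - Complex.I * t) ≠ 0 := by
      have h2 : 1 + (1 + Complex.I * t) / (1 - Complex.I * t) = 2 / (1 - Complex.I * t) := by
        have := hden t
        field_simp; ring
      rw [h2]
      exact div_ne_zero two_ne_zero (hden t)
    have hcont : ContinuousAt
        (fun r : ℝ => cayley (r * ((1 + Complex.I * t) / (1 - Complex.I * t)))) 1 := by
      unfold cayley
      refine ContinuousAt.mul continuousAt_const (ContinuousAt.div (by fun_prop) (by fun_prop) ?_)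
      simpa using hne
    have hl : Tendsto (fun r : ℝ => cayley (r * ((1 + Complex.I * t) / (1 - Complex.I * t))))
        (𝓝[<] 1) (𝓝 (t : ℂ)) := by
      have := hcont.tendsto
      simp only [Complex.ofReal_one, one_mul, cayley_boundary] at this
      exact this.mono_left nhdsWithin_le_nhds
    refine hQt.tendsto.comp (tendsto_nhdsWithin_iff.2 ⟨hl, ?_⟩)
    filter_upwards [hr] with r hr
    exact (cayley_im_pos (hlt hr t)).le

/-- Mean value property of bounded analytic functions on the half-plane. -/
lemma apply_I_eq_integral {G : ℂ → ℂ} {B : ℝ} (hG : AnalyticOnNhd ℂ G upperHalf)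
    (hc : ContinuousOn G {z | 0 ≤ z.im}) (hB : ∀ z, 0 ≤ z.im → ‖G z‖ ≤ B) :
    G Complex.I = ∫ t : ℝ, G t ∂stdCauchy := by
  refine tendsto_nhds_unique (Tendsto.congr' ?_ tendsto_const_nhds)
    (tendsto_circleAverage_cayley hc hB)
  filter_upwards [Ioo_mem_nhdsLT (zero_lt_one (α := ℝ))] with r hr
  have hd : DiffContOnCl ℂ (G ∘ cayley) (Metric.ball 0 |r|) := by
    refine DifferentiableOn.diffContOnCl ?_
    refine (analyticOnNhd_comp_cayley hG).differentiableOn.mono ?_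
    refine Metric.closure_ball_subset_closedBall.trans (Metric.closedBall_subset_ball ?_)
    rw [abs_of_pos hr.1]; exact hr.2
  rw [hd.circleAverage, Function.comp, cayley_zero]

/-- Jensen's formula gives `log |H 0| ≤` the average of `log |H|`, as zeros contribute nonnegative
terms. The tangent line of `u ↦ exp (u / 2)` at `u = log |H 0|` lies below the curve and is affine,
so averaging it transfers the inequality to `|H|^{1/2}`. -/
lemma sqrt_norm_le_circleAverage {H : ℂ → ℂ} (hH : AnalyticOnNhd ℂ H (Metric.ball 0 1)) {r : ℝ}
    (hr : r ∈ Set.Ioo (0 : ℝ) 1) :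
    Real.sqrt ‖H 0‖ ≤ Real.circleAverage (fun z => Real.sqrt ‖H z‖) 0 r := by
  have hrabs : |r| = r := abs_of_pos hr.1
  by_cases h0 : H 0 = 0
  · rw [h0, norm_zero, Real.sqrt_zero]
    exact Real.circleAverage_nonneg_of_nonneg fun z _ => Real.sqrt_nonneg _
  have hsub : Metric.closedBall (0 : ℂ) |r| ⊆ Metric.ball 0 1 := by
    rw [hrabs]; exact Metric.closedBall_subset_ball hr.2
  have hHr : AnalyticOnNhd ℂ H (Metric.closedBall 0 |r|) := hH.mono hsub
  have hlog : Real.log ‖H 0‖ ≤ Real.circleAverage (fun z => Real.log ‖H z‖) 0 r := by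
    rw [hHr.circleAverage_log_norm hr.1.ne' h0, le_add_iff_nonneg_left]
    refine finsum_nonneg fun u => ?_
    by_cases hu : u ∈ Metric.closedBall (0 : ℂ) |r|
    · refine mul_nonneg ?_ ?_
      · exact_mod_cast (MeromorphicOn.AnalyticOnNhd.divisor_nonneg hHr) u
      · rw [zero_sub, norm_neg]
        rcases eq_or_ne u 0 with rfl | hu0
        · simp
        · refine Real.log_nonneg ?_
          rw [← div_eq_mul_inv, one_le_div (by positivity)]
          simpa [hrabs] using hu
    · simp [hu]
  set A := Real.log ‖H 0‖ with hA
  set S := Real.sqrt ‖H 0‖ with hS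
  have hSexp : S = Real.exp (A / 2) := by
    rw [hS, hA, Real.sqrt_eq_rpow, Real.rpow_def_of_pos (norm_pos_iff.2 h0)]
    congr 1; ring
  have hint1 : CircleIntegrable (fun z => Real.log ‖H z‖) 0 r :=
    (hHr.mono Metric.sphere_subset_closedBall).meromorphicOn.circleIntegrable_log_norm
  have hint2 : CircleIntegrable (fun z => S * (1 - A / 2) + (S / 2) • Real.log ‖H z‖) 0 r := by
    refine CircleIntegrable.add (circleIntegrable_const _ _ _) ?_
    exact hint1.const_smul
  have hint3 : CircleIntegrable (fun z => Real.sqrt ‖H z‖) 0 r := by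
    refine ContinuousOn.circleIntegrable hr.1.le ?_
    refine (Real.continuous_sqrt.comp continuous_norm).comp_continuousOn ?_
    exact hHr.continuousOn.mono (by rw [hrabs]; exact Metric.sphere_subset_closedBall)
  have hcod : {z | H z ≠ 0} ∈ codiscreteWithin (Metric.sphere (0 : ℂ) |r|) := by
    refine codiscreteWithin_mono (Metric.sphere_subset_closedBall.trans hsub) ?_
    exact hH.preimage_zero_mem_codiscreteWithin (x := 0) h0 (by simp)
      (Metric.isConnected_ball one_pos)
  have hpt : ∀ z, H z ≠ 0 → S * (1 - A / 2) + (S / 2) • Real.log ‖H z‖ ≤ Real.sqrt ‖H z‖ := by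
    intro z hz
    have h1 : Real.sqrt ‖H z‖ = S * Real.exp (Real.log ‖H z‖ / 2 - A / 2) := by
      rw [hSexp, ← Real.exp_add, Real.sqrt_eq_rpow, Real.rpow_def_of_pos (norm_pos_iff.2 hz)]
      congr 1; ring
    have h2 := Real.add_one_le_exp (Real.log ‖H z‖ / 2 - A / 2)
    have h3 : 0 ≤ S := Real.sqrt_nonneg _
    rw [h1, smul_eq_mul]
    nlinarith
  -- At zeros of `H` the convention `log 0 = 0` can break the tangent inequality. Zeros are
  -- negligible on the circle, so replacing the square root by its maximum with the tangent
  -- expression keeps the average and makes the comparison hold everywhere.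
  have heq : Real.circleAverage (fun z => Real.sqrt ‖H z‖) 0 r = Real.circleAverage
      ((fun z => Real.sqrt ‖H z‖) ⊔ (fun z => S * (1 - A / 2) + (S / 2) • Real.log ‖H z‖)) 0 r := by
    refine Real.circleAverage_congr_codiscreteWithin ?_ hr.1.ne'
    filter_upwards [hcod] with z hz
    exact (max_eq_left (hpt z hz)).symm
  rw [heq]
  have hmono := Real.circleAverage_mono hint2 (f₂ := (fun z => Real.sqrt ‖H z‖) ⊔
      (fun z => S * (1 - A / 2) + (S / 2) • Real.log ‖H z‖)) (by
        exact ⟨hint3.1.sup hint2.1, hint3.2.sup hint2.2⟩) fun z _ => le_max_right _ _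
  refine le_trans ?_ hmono
  rw [Real.circleAverage_fun_add (f₂ := fun z => (S / 2) • Real.log ‖H z‖)
    (circleIntegrable_const _ _ _) hint1.const_smul,
    Real.circleAverage_const, Real.circleAverage_fun_smul, smul_eq_mul]
  have h3 : 0 ≤ S := Real.sqrt_nonneg _
  nlinarith

lemma sqrt_norm_apply_I_le {G : ℂ → ℂ} {B : ℝ} (hG : AnalyticOnNhd ℂ G upperHalf)
    (hc : ContinuousOn G {z | 0 ≤ z.im}) (hB : ∀ z, 0 ≤ z.im → ‖G z‖ ≤ B) :
    Real.sqrt ‖G Complex.I‖ ≤ ∫ t : ℝ, Real.sqrt ‖G t‖ ∂stdCauchy := by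
  have hc' : ContinuousOn (fun z => Real.sqrt ‖G z‖) {z | 0 ≤ z.im} := by fun_prop
  have hlim := tendsto_circleAverage_cayley hc' (B := Real.sqrt B) fun z hz => by
    rw [Real.norm_of_nonneg (Real.sqrt_nonneg _)]
    exact Real.sqrt_le_sqrt (hB z hz)
  refine ge_of_tendsto hlim ?_
  filter_upwards [Ioo_mem_nhdsLT (zero_lt_one (α := ℝ))] with r hr
  have := sqrt_norm_le_circleAverage (analyticOnNhd_comp_cayley hG) hr
  rwa [Function.comp, cayley_zero] at this

/-! ### Convergence of Poisson averages in modular. -/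

/-- This is the semigroup law of Poisson kernels, read off from the mean value property of `i / (y w
- x + i)`, whose real part on the real line is the integrand. -/
lemma integral_inv_one_add_sq_translate (x : ℝ) {y : ℝ} (hy : 0 < y) :
    ∫ s : ℝ, (1 + (x - y * s) ^ 2)⁻¹ ∂stdCauchy = (1 + y) / ((1 + y) ^ 2 + x ^ 2) := by
  set G : ℂ → ℂ := fun w => Complex.I / (y * w - x + Complex.I) with hGdef
  have him : ∀ w : ℂ, 0 ≤ w.im → 1 ≤ ‖y * w - x + Complex.I‖ := by
    intro w hw
    refine le_trans ?_ (Complex.im_le_norm _)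
    simp
    positivity
  have hne : ∀ w : ℂ, 0 ≤ w.im → y * w - x + Complex.I ≠ 0 := by
    intro w hw h
    have := him w hw
    rw [h, norm_zero] at this
    linarith
  have hB : ∀ w : ℂ, 0 ≤ w.im → ‖G w‖ ≤ 1 := by
    intro w hw
    rw [hGdef]
    simp only [norm_div, Complex.norm_I]
    exact div_le_one_of_le₀ (him w hw) (norm_nonneg _)
  have hcont : ContinuousOn G {z | 0 ≤ z.im} := by
    refine ContinuousOn.div (by fun_prop) (by fun_prop) fun w hw => hne w hw
  have h := apply_I_eq_integral (G := G) (fun w hw => by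
    have := hne w (le_of_lt hw)
    refine AnalyticAt.div (by fun_prop) (by fun_prop) this) hcont hB
  have hint : Integrable (fun t : ℝ => G t) stdCauchy := by
    refine Integrable.of_bound (C := 1) ?_ (ae_of_all _ fun t => hB t (by simp))
    exact (hcont.comp_continuous Complex.continuous_ofReal fun t => by simp).aestronglyMeasurable
  have h2 : (∫ t : ℝ, G t ∂stdCauchy).re = ∫ t : ℝ, (G t).re ∂stdCauchy :=
    (Complex.reCLM.integral_comp_comm hint).symm
  rw [← h] at h2
  have h3 : ∀ t : ℝ, (G t).re = (1 + (x - y * t) ^ 2)⁻¹ := by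
    intro t
    simp only [hGdef]
    simp [Complex.div_re, Complex.normSq_apply]
    ring
  simp_rw [h3] at h2
  rw [← h2]
  simp only [hGdef]
  simp [Complex.div_re, Complex.normSq_apply]
  congr 1 <;> ring

/-- A substitute for translation invariance: averaging the translated Cauchy densities gives at most
twice the density, because `(1 + y) / ((1 + y)² + x²) ≤ 2 / (1 + x²)` when `0 < y ≤ 1`. -/
lemma lintegral_lintegral_stdCauchy_le {h : ℝ → ℝ≥0∞} (hh : Measurable h) {y : ℝ} (hy : 0 < y)
    (hy1 : y ≤ 1) :
    ∫⁻ x, ∫⁻ s, h (x + y * s) ∂stdCauchy ∂stdCauchy ≤ 2 * ∫⁻ x, h x ∂stdCauchy := by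
  set p : ℝ → ℝ≥0∞ := fun x => ENNReal.ofReal (Real.pi⁻¹ * (1 + x ^ 2)⁻¹) with hp
  have hpm : Measurable p := by fun_prop
  rw [lintegral_lintegral_swap (by fun_prop)]
  have h1 : ∀ s, ∫⁻ x, h (x + y * s) ∂stdCauchy = ∫⁻ x, p (x - y * s) * h x := by
    intro s
    rw [lintegral_stdCauchy, ← lintegral_add_right_eq_self (fun x => p (x - y * s) * h x) (y * s)]
    simp [hp]
  simp_rw [h1]
  rw [lintegral_lintegral_swap (by fun_prop), lintegral_stdCauchy,
    ← lintegral_const_mul _ (by fun_prop)]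
  refine lintegral_mono fun x => ?_
  simp only
  rw [lintegral_mul_const _ (by fun_prop), ← mul_assoc]
  gcongr
  rw [hp]
  simp only
  rw [← ofReal_integral_eq_lintegral_ofReal, integral_const_mul,
    integral_inv_one_add_sq_translate x hy]
  · rw [← ENNReal.ofReal_ofNat 2, ← ENNReal.ofReal_mul (by norm_num)]
    refine ENNReal.ofReal_le_ofReal ?_
    rw [mul_left_comm]
    refine mul_le_mul_of_nonneg_left ?_ (by positivity)
    rw [← div_eq_mul_inv, div_le_div_iff₀ (by positivity) (by positivity)]
    nlinarith [sq_nonneg x, mul_nonneg hy.le (sq_nonneg x)]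
  · refine Integrable.of_bound (C := 1) (Measurable.aestronglyMeasurable (by fun_prop))
      (ae_of_all _ fun t => ?_)
    rw [Real.norm_of_nonneg (by positivity)]
    exact density_le_one _
  · exact ae_of_all _ fun t => by positivity

lemma tendsto_lintegral_enorm_translate_sub {g : ℝ → ℂ} (hg : Integrable g) :
    Tendsto (fun h : ℝ => ∫⁻ x, ‖g (x + h) - g x‖ₑ) (𝓝 0) (𝓝 0) := by
  let τ : C(ℝ, C(ℝ, ℝ)) := (ContinuousMap.mk (fun p : ℝ × ℝ => p.2 + p.1) (by fun_prop)).curry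
  have hmp : ∀ h, MeasurePreserving (τ h) (volume : Measure ℝ) volume :=
    fun h => measurePreserving_add_right volume h
  have key := Filter.Tendsto.compMeasurePreservingLp (p := 1) (l := 𝓝 (0 : ℝ))
    (f := fun _ => hg.toL1 g) (f₀ := hg.toL1 g) (g := τ) (g₀ := τ 0) tendsto_const_nhds
    (τ.continuous.tendsto 0) hmp (hmp 0) (by simp)
  rw [tendsto_iff_edist_tendsto_0] at key
  refine key.congr fun h => ?_
  have h1 := hg.coeFn_toL1
  have e : ∀ a, (Lp.compMeasurePreserving (τ a) (hmp a) (hg.toL1 g) : ℝ → ℂ) =ᵐ[volume]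
      fun x => g (x + a) := by
    intro a
    refine (Lp.coeFn_compMeasurePreserving _ (hmp a)).trans ?_
    exact (hmp a).quasiMeasurePreserving.ae_eq_comp h1
  rw [Lp.edist_def, eLpNorm_one_eq_lintegral_enorm]
  refine lintegral_congr_ae ?_
  filter_upwards [e h, e 0, Lp.coeFn_sub (Lp.compMeasurePreserving (τ h) (hmp h) (hg.toL1 g))
    (Lp.compMeasurePreserving (τ 0) (hmp 0) (hg.toL1 g))] with x hx hx0 hs
  rw [Pi.sub_apply, hx, hx0, add_zero]

/-- Jensen's inequality for the modular. -/
lemma modular_integral_le {Ψ : ℝ≥0 → ℝ≥0} (hconv : ConvexOn ℝ≥0 Set.univ Ψ)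
    (hcont : Continuous Ψ) (hmono : Monotone Ψ) {α : Type*} [MeasurableSpace α] {P : Measure α}
    [IsProbabilityMeasure P] {X : α → ℂ} (hX : Integrable X P) (K : ℝ≥0) :
    (Ψ (K * ‖∫ a, X a ∂P‖₊) : ℝ≥0∞) ≤ ∫⁻ a, (Ψ (K * ‖X a‖₊) : ℝ≥0∞) ∂P := by
  -- Jensen's inequality for real integrals requires `Ψ` of the variable to be integrable; otherwise
  -- the right side is infinite.
  by_cases htop : ∫⁻ a, (Ψ (K * ‖X a‖₊) : ℝ≥0∞) ∂P = ∞
  · rw [htop]; exact le_top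
  set φ : ℝ → ℝ := fun t => (Ψ t.toNNReal : ℝ) with hφ
  have hφc : ConvexOn ℝ (Set.Ici 0) φ := by
    refine ⟨convex_Ici 0, fun a ha b hb s t hs ht hst => ?_⟩
    have ha' : 0 ≤ a := ha
    have hb' : 0 ≤ b := hb
    have := hconv.2 (Set.mem_univ a.toNNReal) (Set.mem_univ b.toNNReal)
      (zero_le : 0 ≤ s.toNNReal) (zero_le : 0 ≤ t.toNNReal) (by
        rw [← Real.toNNReal_add hs ht, hst, Real.toNNReal_one])
    have e : (s • a + t • b).toNNReal =
        s.toNNReal • a.toNNReal + t.toNNReal • b.toNNReal := by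
      simp only [smul_eq_mul]
      rw [Real.toNNReal_add (by positivity) (by positivity), Real.toNNReal_mul hs,
        Real.toNNReal_mul ht]
    simp only [hφ, e]
    have h2 := NNReal.coe_le_coe.2 this
    simpa [Real.coe_toNNReal _ hs, Real.coe_toNNReal _ ht] using h2
  have hφcont : Continuous φ := by fun_prop
  have hmeas : AEStronglyMeasurable (fun a => φ (K * ‖X a‖)) P :=
    hφcont.comp_aestronglyMeasurable (hX.aestronglyMeasurable.norm.const_mul _)
  have hval : ∀ a, φ (K * ‖X a‖) = (Ψ (K * ‖X a‖₊) : ℝ) := by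
    intro a
    simp only [hφ]
    congr 2
    ext
    rw [Real.coe_toNNReal _ (by positivity)]
    simp
  have hint : Integrable (fun a => φ (K * ‖X a‖)) P := by
    refine ⟨hmeas, ?_⟩
    rw [hasFiniteIntegral_iff_enorm]
    refine lt_of_le_of_lt (lintegral_mono fun a => ?_) (lt_top_iff_ne_top.2 htop)
    rw [hval a]
    simp [← ofReal_norm]
  have hJ := hφc.map_integral_le hφcont.continuousOn isClosed_Ici (μ := P)
    (f := fun a => K * ‖X a‖) (ae_of_all _ fun a => by
      simp only [Set.mem_Ici]; positivity) (hX.norm.const_mul _) hint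
  have h1 : (Ψ (K * ‖∫ a, X a ∂P‖₊) : ℝ) ≤ ∫ a, φ (K * ‖X a‖) ∂P := by
    refine le_trans ?_ hJ
    simp only [hφ]
    rw [NNReal.coe_le_coe]
    refine hmono ?_
    rw [← NNReal.coe_le_coe, Real.coe_toNNReal _ (by positivity), integral_const_mul]
    simp only [NNReal.coe_mul, coe_nnnorm]
    exact mul_le_mul_of_nonneg_left (norm_integral_le_integral_norm _) K.2
  rw [← ENNReal.ofReal_coe_nnreal]
  refine (ENNReal.ofReal_le_ofReal h1).trans ?_
  rw [ofReal_integral_eq_lintegral_ofReal hint (ae_of_all _ fun a => by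
    exact (NNReal.coe_nonneg _ : 0 ≤ φ (K * ‖X a‖)))]
  refine lintegral_mono fun a => ?_
  simp only [hval, ENNReal.ofReal_coe_nnreal, le_refl]

/-- On `[0, B]` a convex function lies below its chord from the origin. -/
lemma convex_le_linear {Ψ : ℝ≥0 → ℝ≥0} (hconv : ConvexOn ℝ≥0 Set.univ Ψ) (h0 : Ψ 0 = 0)
    {t B : ℝ≥0} (ht : t ≤ B) : Ψ t ≤ Ψ B / B * t := by
  rcases eq_or_ne B 0 with rfl | hB
  · simp [nonpos_iff_eq_zero.1 ht, h0]
  have h1 : t / B ≤ 1 := div_le_one_of_le₀ ht zero_le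
  have := hconv.2 (Set.mem_univ B) (Set.mem_univ 0) (zero_le : 0 ≤ t / B)
    (zero_le : 0 ≤ 1 - t / B) (add_tsub_cancel_of_le h1)
  simp only [smul_eq_mul, mul_zero, add_zero, h0, div_mul_cancel₀ t hB] at this
  refine this.trans (le_of_eq ?_)
  ring

lemma convex_add_le {Ψ : ℝ≥0 → ℝ≥0} (hconv : ConvexOn ℝ≥0 Set.univ Ψ) (a b : ℝ≥0) :
    Ψ (a + b) ≤ Ψ (2 * a) + Ψ (2 * b) := by
  have h := hconv.2 (Set.mem_univ (2 * a)) (Set.mem_univ (2 * b)) (zero_le : 0 ≤ (1 / 2 : ℝ≥0))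
    (zero_le : 0 ≤ (1 / 2 : ℝ≥0)) (by rw [← NNReal.coe_inj]; push_cast; norm_num)
  simp only [smul_eq_mul] at h
  have e : 1 / 2 * (2 * a) + 1 / 2 * (2 * b) = a + b := by
    rw [← NNReal.coe_inj]; push_cast; ring
  rw [e] at h
  refine h.trans ?_
  have h3 : ∀ u : ℝ≥0, 1 / 2 * u ≤ u := fun u => by
    rw [← NNReal.coe_le_coe]; push_cast; linarith [u.2]
  gcongr <;> exact h3 _

/-- After exchanging the integrals, the inner one is the `L¹` modulus of continuity at shift `y s`;
it is dominated by `2 ‖g‖₁`, and translation is continuous in `L¹`. -/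
lemma tendsto_lintegral_translate_average {g : ℝ → ℂ} (hgm : Measurable g) (hg : Integrable g) :
    Tendsto (fun y : ℝ => ∫⁻ x, ∫⁻ s, ‖g (x + y * s) - g x‖ₑ ∂stdCauchy) (𝓝[>] 0) (𝓝 0) := by
  have h1 : ∀ y : ℝ, ∫⁻ x, ∫⁻ s, ‖g (x + y * s) - g x‖ₑ ∂stdCauchy =
      ∫⁻ s, (fun h : ℝ => ∫⁻ x, ‖g (x + h) - g x‖ₑ) (y * s) ∂stdCauchy := by
    intro y
    rw [lintegral_lintegral_swap (by fun_prop)]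
  simp_rw [h1]
  have hω := tendsto_lintegral_enorm_translate_sub hg
  have hωm : Measurable fun h : ℝ => ∫⁻ x, ‖g (x + h) - g x‖ₑ := by
    refine Measurable.lintegral_prod_right' (f := fun p : ℝ × ℝ => ‖g (p.2 + p.1) - g p.2‖ₑ) ?_
    fun_prop
  have hb : ∀ h : ℝ, ∫⁻ x, ‖g (x + h) - g x‖ₑ ≤ 2 * ∫⁻ x, ‖g x‖ₑ := by
    intro h
    calc ∫⁻ x, ‖g (x + h) - g x‖ₑ ≤ ∫⁻ x, (‖g (x + h)‖ₑ + ‖g x‖ₑ) :=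
          lintegral_mono fun x => enorm_sub_le
      _ = 2 * ∫⁻ x, ‖g x‖ₑ := by
          rw [lintegral_add_left (by fun_prop), lintegral_add_right_eq_self (fun x => ‖g x‖ₑ),
            two_mul]
  have := tendsto_lintegral_filter_of_dominated_convergence (μ := stdCauchy) (l := 𝓝[>] (0 : ℝ))
    (F := fun y s => (fun h : ℝ => ∫⁻ x, ‖g (x + h) - g x‖ₑ) (y * s)) (f := fun _ => 0)
    (fun _ => 2 * ∫⁻ x, ‖g x‖ₑ)
    (Eventually.of_forall fun y => hωm.comp (by fun_prop))
    (Eventually.of_forall fun y => ae_of_all _ fun s => hb _)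
    (by
      rw [lintegral_const]
      exact ENNReal.mul_ne_top (ENNReal.mul_ne_top (by simp) hg.2.ne) (by simp))
    (ae_of_all _ fun s => by
      refine hω.comp ?_
      have : Tendsto (fun y : ℝ => y * s) (𝓝 0) (𝓝 (0 * s)) := tendsto_id.mul_const s
      rw [zero_mul] at this
      exact this.mono_left nhdsWithin_le_nhds)
  simpa using this

/-- Jensen moves `Ψ` inside the average, and two uses of `convex_add_le` separate the bounded part
`g` (factor `2K`) from the remainder `r` (factor `4K`). Increments of `g` are at most `2B`, so `Ψ`
is replaced there by its chord on `[0, 4KB]`, leaving an `L¹` modulus of continuity; `hAν` controls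
the translates of `r`. -/
lemma modular_poissonAvg_sub_le {ν : Measure ℝ} (hν : ν ≤ volume) {A : ℝ≥0∞}
    {y : ℝ} (hy : 0 < y) (hAν : ∀ h : ℝ → ℝ≥0∞, Measurable h →
      ∫⁻ x, ∫⁻ s, h (x + y * s) ∂stdCauchy ∂ν ≤ A * ∫⁻ x, h x ∂ν)
    {Ψ : ℝ≥0 → ℝ≥0} (hconv : ConvexOn ℝ≥0 Set.univ Ψ) (hcont : Continuous Ψ) (hmono : Monotone Ψ)
    (h0 : Ψ 0 = 0) {f g r : ℝ → ℂ} (hfi : Integrable f stdCauchy)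
    (hg : Measurable g) (hr : Measurable r) (hfgr : ∀ x, f x = g x + r x) {B : ℝ≥0}
    (hgB : ∀ x, ‖g x‖₊ ≤ B) (K : ℝ≥0) :
    ∫⁻ x, (Ψ (K * ‖poissonAvg f y x - f x‖₊) : ℝ≥0∞) ∂ν ≤
      (Ψ (4 * K * B) / (4 * K * B) * (2 * K) : ℝ≥0) *
        (∫⁻ x, ∫⁻ s, ‖g (x + y * s) - g x‖ₑ ∂stdCauchy) +
      (A + 1) * ∫⁻ x, (Ψ (4 * K * ‖r x‖₊) : ℝ≥0∞) ∂ν := by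
  set L : ℝ≥0 := Ψ (4 * K * B) / (4 * K * B) * (2 * K) with hL
  have hΨm : Measurable Ψ := hcont.measurable
  have hpt : ∀ x, (Ψ (K * ‖poissonAvg f y x - f x‖₊) : ℝ≥0∞) ≤
      L * (∫⁻ s, ‖g (x + y * s) - g x‖ₑ ∂stdCauchy) +
        ((∫⁻ s, (Ψ (4 * K * ‖r (x + y * s)‖₊) : ℝ≥0∞) ∂stdCauchy) + Ψ (4 * K * ‖r x‖₊)) := by
    intro x
    have hi := integrable_comp_affine hfi x hy
    have e : poissonAvg f y x - f x = ∫ s, (f (x + y * s) - f x) ∂stdCauchy := by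
      rw [integral_sub hi (integrable_const _), integral_const]
      simp [poissonAvg]
    rw [e]
    refine (modular_integral_le hconv hcont hmono (hi.sub (integrable_const _)) K).trans ?_
    calc ∫⁻ s, (Ψ (K * ‖f (x + y * s) - f x‖₊) : ℝ≥0∞) ∂stdCauchy
        ≤ ∫⁻ s, (L * ‖g (x + y * s) - g x‖ₑ +
          ((Ψ (4 * K * ‖r (x + y * s)‖₊) : ℝ≥0∞) + Ψ (4 * K * ‖r x‖₊))) ∂stdCauchy := by
          refine lintegral_mono fun s => ?_
          have h1 : ‖f (x + y * s) - f x‖₊ ≤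
              ‖g (x + y * s) - g x‖₊ + (‖r (x + y * s)‖₊ + ‖r x‖₊) := by
            have : f (x + y * s) - f x = (g (x + y * s) - g x) + (r (x + y * s) - r x) := by
              rw [hfgr, hfgr]; ring
            rw [this]
            exact (nnnorm_add_le _ _).trans (by gcongr; exact nnnorm_sub_le _ _)
          have h2 : Ψ (K * ‖f (x + y * s) - f x‖₊) ≤ Ψ (2 * K * ‖g (x + y * s) - g x‖₊) +
              (Ψ (4 * K * ‖r (x + y * s)‖₊) + Ψ (4 * K * ‖r x‖₊)) := by
            calc Ψ (K * ‖f (x + y * s) - f x‖₊)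
                ≤ Ψ (K * ‖g (x + y * s) - g x‖₊ + (K * ‖r (x + y * s)‖₊ + K * ‖r x‖₊)) := by
                  refine hmono ?_
                  rw [← mul_add, ← mul_add]
                  gcongr
              _ ≤ _ := (convex_add_le hconv _ _).trans (by
                  rw [← mul_assoc]
                  gcongr
                  rw [mul_add]
                  refine (convex_add_le hconv _ _).trans (le_of_eq ?_)
                  congr 2 <;> ring)
          have h3 : Ψ (2 * K * ‖g (x + y * s) - g x‖₊) ≤ L * ‖g (x + y * s) - g x‖₊ := by
            refine (convex_le_linear hconv h0 (B := 4 * K * B) ?_).trans (le_of_eq ?_)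
            · calc 2 * K * ‖g (x + y * s) - g x‖₊ ≤ 2 * K * (B + B) := by
                    gcongr
                    exact (nnnorm_sub_le _ _).trans (add_le_add (hgB _) (hgB _))
                _ = 4 * K * B := by ring
            · rw [hL]; ring
          have h4 := h2.trans (add_le_add_left h3 _)
          rw [enorm_eq_nnnorm]
          refine (ENNReal.coe_le_coe.2 h4).trans (le_of_eq ?_)
          push_cast
          rfl
      _ = _ := by
          rw [lintegral_add_left (by fun_prop), lintegral_add_right _ (by fun_prop),
            lintegral_const_mul _ (by fun_prop), lintegral_const]
          simp
  refine (lintegral_mono hpt).trans ?_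
  have hm1 : Measurable fun x => ∫⁻ s, ‖g (x + y * s) - g x‖ₑ ∂stdCauchy := by
    refine Measurable.lintegral_prod_right'
      (f := fun p : ℝ × ℝ => ‖g (p.1 + y * p.2) - g p.1‖ₑ) ?_
    fun_prop
  rw [lintegral_add_left (by fun_prop), lintegral_const_mul _ hm1, lintegral_add_right _
    (by fun_prop), add_mul, one_mul]
  gcongr
  exact hAν (fun x => (Ψ (4 * K * ‖r x‖₊) : ℝ≥0∞)) (by fun_prop)

/-- Poisson averages converge in modular to the boundary function. -/
theorem tendsto_modular_poissonAvg_sub {ν : Measure ℝ} (hν : ν ≤ volume) {A : ℝ≥0∞}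
    (hA : A ≠ ∞) (hAν : ∀ y : ℝ, 0 < y → y ≤ 1 → ∀ h : ℝ → ℝ≥0∞, Measurable h →
      ∫⁻ x, ∫⁻ s, h (x + y * s) ∂stdCauchy ∂ν ≤ A * ∫⁻ x, h x ∂ν)
    {Ψ : ℝ≥0 → ℝ≥0} (hconv : ConvexOn ℝ≥0 Set.univ Ψ) (hcont : Continuous Ψ) (hmono : Monotone Ψ)
    (h0 : Ψ 0 = 0) {f : ℝ → ℂ} (hf : Measurable f) (hfi : Integrable f stdCauchy)
    (hΨ : ∀ K : ℝ≥0, ∫⁻ x, (Ψ (K * ‖f x‖₊) : ℝ≥0∞) ∂ν ≠ ∞) (K : ℝ≥0) :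
    Tendsto (fun y => ∫⁻ x, (Ψ (K * ‖poissonAvg f y x - f x‖₊) : ℝ≥0∞) ∂ν) (𝓝[>] 0) (𝓝 0) := by
  have hΨm : Measurable Ψ := hcont.measurable
  -- Truncating both values and support makes `g n` bounded and Lebesgue integrable, while `r n` is
  -- dominated by `f` and eventually zero at each point.
  set S : ℕ → Set ℝ := fun n => {x | ‖f x‖₊ ≤ n ∧ |x| ≤ n} with hS
  have hSm : ∀ n, MeasurableSet (S n) := fun n =>
    (measurableSet_le hf.nnnorm measurable_const).inter
      (measurableSet_le (continuous_abs (G := ℝ)).measurable measurable_const)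
  set g : ℕ → ℝ → ℂ := fun n => (S n).indicator f with hg
  set r : ℕ → ℝ → ℂ := fun n => (S n)ᶜ.indicator f with hr
  have hgm : ∀ n, Measurable (g n) := fun n => hf.indicator (hSm n)
  have hrm : ∀ n, Measurable (r n) := fun n => hf.indicator (hSm n).compl
  have hgB : ∀ n x, ‖g n x‖₊ ≤ (n : ℝ≥0) := by
    intro n x
    by_cases hx : x ∈ S n
    · simp only [hg, Set.indicator_of_mem hx]; exact hx.1
    · simp [hg, Set.indicator_of_notMem hx]
  have hgi : ∀ n, Integrable (g n) := by
    intro n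
    rw [hg, integrable_indicator_iff (hSm n)]
    refine IntegrableOn.of_bound ?_ hf.aestronglyMeasurable (n : ℝ) ?_
    · refine (measure_mono (t := Set.Icc (-(n : ℝ)) n) fun x hx => ?_).trans_lt (by simp)
      exact abs_le.1 hx.2
    · filter_upwards [ae_restrict_mem (hSm n)] with x hx
      exact_mod_cast hx.1
  have hrlim : Tendsto (fun n => ∫⁻ x, (Ψ (4 * K * ‖r n x‖₊) : ℝ≥0∞) ∂ν) atTop (𝓝 0) := by
    have := tendsto_lintegral_of_dominated_convergence (μ := ν)
      (F := fun n x => (Ψ (4 * K * ‖r n x‖₊) : ℝ≥0∞)) (f := fun _ => 0)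
      (fun x => (Ψ (4 * K * ‖f x‖₊) : ℝ≥0∞))
      (fun n => by have := hrm n; fun_prop)
      (fun n => ae_of_all _ fun x => by
        refine ENNReal.coe_le_coe.2 (hmono ?_)
        gcongr
        exact norm_indicator_le_norm_self f x)
      (hΨ _)
      (ae_of_all _ fun x => by
        refine tendsto_const_nhds.congr' ?_
        obtain ⟨n₁, h₁⟩ := exists_nat_ge ‖f x‖₊
        obtain ⟨n₂, h₂⟩ := exists_nat_ge |x|
        filter_upwards [eventually_ge_atTop n₁, eventually_ge_atTop n₂] with n hn1 hn2
        have : x ∈ S n := ⟨h₁.trans (by exact_mod_cast hn1), h₂.trans (by exact_mod_cast hn2)⟩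
        simp [hr, this, h0])
    simpa using this
  rw [ENNReal.tendsto_nhds_zero]
  intro ε hε
  have hε2 : 0 < ε / 2 := ENNReal.half_pos hε.ne'
  have h1 : Tendsto (fun n => (A + 1) * ∫⁻ x, (Ψ (4 * K * ‖r n x‖₊) : ℝ≥0∞) ∂ν) atTop (𝓝 0) := by
    simpa using ENNReal.Tendsto.const_mul hrlim (Or.inr (ENNReal.add_ne_top.2 ⟨hA, by simp⟩))
  obtain ⟨n, hn⟩ := (ENNReal.tendsto_nhds_zero.1 h1 _ hε2).exists
  have h2 : Tendsto (fun y : ℝ => (Ψ (4 * K * n) / (4 * K * n) * (2 * K) : ℝ≥0) *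
      (∫⁻ x, ∫⁻ s, ‖g n (x + y * s) - g n x‖ₑ ∂stdCauchy)) (𝓝[>] 0) (𝓝 0) := by
    have := ENNReal.Tendsto.const_mul (tendsto_lintegral_translate_average (hgm n) (hgi n))
      (Or.inr (ENNReal.coe_ne_top (r := Ψ (4 * K * n) / (4 * K * n) * (2 * K))))
    rwa [mul_zero] at this
  filter_upwards [ENNReal.tendsto_nhds_zero.1 h2 _ hε2,
    Ioc_mem_nhdsGT (zero_lt_one (α := ℝ))] with y hy2 hy
  refine (modular_poissonAvg_sub_le hν hy.1 (hAν y hy.1 hy.2) hconv hcont hmono h0 hfi (hgm n)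
    (hrm n) (fun x => ?_) (hgB n) K).trans ?_
  · simp [hg, hr, Set.indicator_self_add_compl_apply]
  · exact (add_le_add hy2 hn).trans (by rw [ENNReal.add_halves])

/-! ### Weak limits in `L²` and boundary values. -/

/-- Banach–Alaoglu in the dual combined with the Riesz identification. Convergence along an
ultrafilter avoids extracting subsequences, hence any separability. -/
lemma exists_weak_limit {H : Type*} [NormedAddCommGroup H] [InnerProductSpace ℂ H]
    [CompleteSpace H] {ι : Type*} (U : Ultrafilter ι) {u : ι → H} {M : ℝ}
    (hu : ∀ i, ‖u i‖ ≤ M) :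
    ∃ g : H, ∀ h : H, Tendsto (fun i => inner ℂ (u i) h) U (𝓝 (inner ℂ g h)) := by
  have hc := WeakDual.isCompact_closedBall (0 : StrongDual ℂ H) M
  rw [isCompact_iff_ultrafilter_le_nhds] at hc
  let v : ι → WeakDual ℂ H := fun i => StrongDual.toWeakDual (InnerProductSpace.toDual ℂ H (u i))
  obtain ⟨x, -, hx⟩ := hc (U.map v) (by
    rw [le_principal_iff]
    refine Filter.Eventually.of_forall (f := (U : Filter ι)) fun i => ?_
    simpa [v] using hu i)
  refine ⟨(InnerProductSpace.toDual ℂ H).symm (WeakDual.toStrongDual x), fun h => ?_⟩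
  have h1 : Tendsto v U (𝓝 x) := hx
  have h2 := ((WeakDual.eval_continuous h).tendsto x).comp h1
  rw [InnerProductSpace.toDual_symm_apply]
  exact h2

/-- Weak sequential compactness in `L²`, along an ultrafilter. -/
lemma exists_weak_limit_memLp {α : Type*} [MeasurableSpace α] {μ : Measure α} {ι : Type*}
    (U : Ultrafilter ι) {u : ι → α → ℂ} {M : ℝ≥0} (hu : ∀ i, MemLp (u i) 2 μ)
    (hM : ∀ i, eLpNorm (u i) 2 μ ≤ M) :
    ∃ g : α → ℂ, Measurable g ∧ MemLp g 2 μ ∧ ∀ h : α → ℂ, MemLp h 2 μ →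
      Tendsto (fun i => ∫ x, u i x * h x ∂μ) U (𝓝 (∫ x, g x * h x ∂μ)) := by
  obtain ⟨g, hg⟩ := exists_weak_limit U (u := fun i => (hu i).toLp (u i)) (M := M) fun i => by
    rw [Lp.norm_toLp]
    exact ENNReal.toReal_le_coe_of_le_coe (hM i)
  have hgm := Lp.aestronglyMeasurable g
  set g' : α → ℂ := hgm.mk g with hg'
  have hgg : g =ᵐ[μ] g' := hgm.ae_eq_mk
  refine ⟨g', hgm.stronglyMeasurable_mk.measurable, (memLp_congr_ae hgg).1 (Lp.memLp g),
    fun h hh => ?_⟩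
  have hs : MemLp (fun x => (starRingEnd ℂ) (h x)) 2 μ := hh.star
  have h1 := ((Complex.continuous_conj.tendsto _).comp (hg (hs.toLp _)))
  have key : ∀ v : Lp ℂ 2 μ, ∀ v' : α → ℂ, v =ᵐ[μ] v' →
      (starRingEnd ℂ) (inner ℂ v (hs.toLp _)) = ∫ x, v' x * h x ∂μ := by
    intro v v' hv
    rw [inner_conj_symm, L2.inner_def]
    refine integral_congr_ae ?_
    filter_upwards [hv, hs.coeFn_toLp] with x hx hx2
    rw [hx, hx2]
    simp [mul_comm]
  rw [key g g' hgg] at h1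
  refine h1.congr fun i => ?_
  exact key _ _ (hu i).coeFn_toLp

lemma eLpNorm_two_sq {α : Type*} [MeasurableSpace α] {μ : Measure α} (f : α → ℂ) :
    eLpNorm f 2 μ = (∫⁻ x, ‖f x‖ₑ ^ 2 ∂μ) ^ (1 / 2 : ℝ) := by
  rw [eLpNorm_eq_lintegral_rpow_enorm_toReal (by norm_num) (by norm_num)]
  simp

/-- The Poisson kernel at `x + i y` as a density with respect to the Cauchy distribution. -/
noncomputable def relKernel (x y t : ℝ) : ℂ := ((y * (1 + t ^ 2) / ((x - t) ^ 2 + y ^ 2) : ℝ) : ℂ)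

lemma continuous_relKernel (x : ℝ) {y : ℝ} (hy : 0 < y) : Continuous (relKernel x y) := by
  unfold relKernel
  have : ∀ t : ℝ, (x - t) ^ 2 + y ^ 2 ≠ 0 := fun t => by positivity
  fun_prop (disch := exact this _)

lemma exists_norm_relKernel_le (x : ℝ) {y : ℝ} (hy : 0 < y) :
    ∃ A : ℝ, ∀ t, ‖relKernel x y t‖ ≤ A := by
  refine ⟨y * ((1 + 2 * x ^ 2) / y ^ 2 + 2), fun t => ?_⟩
  have h2 : 0 < (x - t) ^ 2 + y ^ 2 := by positivity
  rw [relKernel, Complex.norm_real, Real.norm_of_nonneg (by positivity), div_le_iff₀ h2, mul_assoc]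
  refine mul_le_mul_of_nonneg_left ?_ hy.le
  have := one_add_sq_le (x := x) hy t
  rwa [show (t - x) ^ 2 = (x - t) ^ 2 by ring] at this

/-- With respect to the Cauchy distribution the Poisson kernel is a bounded continuous function,
hence an admissible test function for weak limits. -/
lemma poissonAvg_eq_integral_relKernel (f : ℝ → ℂ) (x : ℝ) {y : ℝ} (hy : 0 < y) :
    poissonAvg f y x = ∫ t, f t * relKernel x y t ∂stdCauchy := by
  rw [poissonAvg_eq f hy, integral_stdCauchy, ← integral_const_mul]
  congr 1
  ext t
  have h1 : (x - t) ^ 2 + y ^ 2 ≠ 0 := by positivity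
  have h2 : (1 + t ^ 2) ≠ 0 := by positivity
  have h3 : Real.pi ≠ 0 := Real.pi_ne_zero
  have e : Real.pi⁻¹ * (1 + t ^ 2)⁻¹ * (y * (1 + t ^ 2) / ((x - t) ^ 2 + y ^ 2)) =
      1 / Real.pi * (y / ((x - t) ^ 2 + y ^ 2)) := by field_simp
  have e' := congrArg (fun r : ℝ => (r : ℂ)) e
  simp only [Complex.ofReal_mul] at e'
  rw [relKernel, poissonIntegrand, Complex.real_smul, Complex.ofReal_mul]
  simp only [Complex.add_re, Complex.ofReal_re, Complex.mul_re, Complex.I_re, mul_zero,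
    Complex.ofReal_im, Complex.I_im, mul_one, sub_self, add_zero, Complex.add_im, Complex.mul_im,
    zero_add]
  rw [Complex.ofReal_div 1, Complex.ofReal_one] at e'
  linear_combination (-f t) * e'

lemma memLp_two_of_bound {h : ℝ → ℂ} (hh : Continuous h) {A : ℝ} (hA : ∀ t, ‖h t‖ ≤ A) :
    MemLp h 2 stdCauchy :=
  MemLp.of_bound hh.aestronglyMeasurable A (ae_of_all _ hA)

lemma slice_continuous {F : ℂ → ℂ} (hF : AnalyticOnNhd ℂ F upperHalf) {y : ℝ} (hy : 0 < y) :
    Continuous (slice F y) := by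
  unfold slice
  exact hF.continuousOn.comp_continuous (by fun_prop) fun x => by simpa [upperHalf] using hy

/-- The affine map sends the closed half-plane into `Im ≥ ε` and `i` to `x + i(y + ε)`, so
statements at `i` become statements about heights `ε` and `y + ε`. -/
lemma shift_regular {F : ℂ → ℂ} (hF : AnalyticOnNhd ℂ F upperHalf) (x : ℝ) {y ε : ℝ} (hy : 0 < y)
    (hε : 0 < ε) :
    AnalyticOnNhd ℂ (fun w => F (x + y * w + ε * Complex.I)) upperHalf ∧
      ContinuousOn (fun w => F (x + y * w + ε * Complex.I)) {z | 0 ≤ z.im} := by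
  have hmem : ∀ w : ℂ, 0 ≤ w.im → (x + y * w + ε * Complex.I : ℂ) ∈ upperHalf := by
    intro w hw
    simp [upperHalf]
    positivity
  refine ⟨fun w hw => ?_, ?_⟩
  · exact AnalyticAt.fun_comp (hF _ (hmem w (le_of_lt hw))) (by fun_prop)
  · exact hF.continuousOn.comp (by fun_prop) fun w hw => hmem w hw

lemma slice_add_eq_poissonAvg {F : ℂ → ℂ} (hF : AnalyticOnNhd ℂ F upperHalf)
    (hbd : ∀ y₀ : ℝ, 0 < y₀ → ∃ M : ℝ, ∀ z : ℂ, y₀ ≤ z.im → ‖F z‖ ≤ M) (x : ℝ) {y ε : ℝ}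
    (hy : 0 < y) (hε : 0 < ε) :
    slice F (y + ε) x = poissonAvg (slice F ε) y x := by
  obtain ⟨M, hM⟩ := hbd ε hε
  obtain ⟨h1, h2⟩ := shift_regular hF x hy hε
  have := apply_I_eq_integral h1 h2 (B := M) fun w hw => hM _ (by
    have hw' : 0 ≤ w.im := hw
    simp
    positivity)
  rw [poissonAvg, slice]
  convert this using 2
  · push_cast; ring
  · simp [slice]

lemma sqrt_norm_slice_add_le {F : ℂ → ℂ} (hF : AnalyticOnNhd ℂ F upperHalf)
    (hbd : ∀ y₀ : ℝ, 0 < y₀ → ∃ M : ℝ, ∀ z : ℂ, y₀ ≤ z.im → ‖F z‖ ≤ M) (x : ℝ) {y ε : ℝ}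
    (hy : 0 < y) (hε : 0 < ε) :
    Real.sqrt ‖slice F (y + ε) x‖ ≤
      ‖poissonAvg (fun t => (Real.sqrt ‖slice F ε t‖ : ℂ)) y x‖ := by
  obtain ⟨M, hM⟩ := hbd ε hε
  obtain ⟨h1, h2⟩ := shift_regular hF x hy hε
  have := sqrt_norm_apply_I_le h1 h2 (B := M) fun w hw => hM _ (by
    have hw' : 0 ≤ w.im := hw
    simp
    positivity)
  rw [poissonAvg, integral_complex_ofReal, Complex.norm_real]
  have e1 : slice F (y + ε) x = F (x + y * Complex.I + ε * Complex.I) := by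
    rw [slice]; congr 1; push_cast; ring
  have e2 : ∀ s : ℝ, slice F ε (x + y * s) = F (x + y * s + ε * Complex.I) := fun s => by
    simp [slice]
  simp_rw [e1, e2]
  exact this.trans (le_abs_self _)

lemma convexOn_sq_nnreal : ConvexOn ℝ≥0 Set.univ (fun t : ℝ≥0 => t ^ 2) := by
  refine ⟨convex_univ, fun a _ b _ s t _ _ hst => ?_⟩
  rw [← NNReal.coe_le_coe]
  simp only [smul_eq_mul]
  push_cast
  have h : (s : ℝ) + t = 1 := by exact_mod_cast hst
  have h' : (s : ℝ) = 1 - t := by linarith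
  have ht : (0 : ℝ) ≤ t := t.2
  have hs : (0 : ℝ) ≤ 1 - t := by rw [← h']; exact s.2
  rw [h']
  nlinarith [mul_nonneg (mul_nonneg hs ht) (sq_nonneg ((a : ℝ) - b))]

lemma lintegral_sq_poissonAvg_le {g : ℝ → ℂ} (hgm : Measurable g) (hg : Integrable g stdCauchy)
    {y : ℝ} (hy : 0 < y) (hy1 : y ≤ 1) :
    ∫⁻ x, ‖poissonAvg g y x‖ₑ ^ 2 ∂stdCauchy ≤ 2 * ∫⁻ x, ‖g x‖ₑ ^ 2 ∂stdCauchy := by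
  refine le_trans (lintegral_mono fun x => ?_)
    (lintegral_lintegral_stdCauchy_le (h := fun x => ‖g x‖ₑ ^ 2) (by fun_prop) hy hy1)
  have := modular_integral_le convexOn_sq_nnreal (by fun_prop)
    (fun a b h => pow_le_pow_left₀ zero_le h 2) (integrable_comp_affine hg x hy) 1
  simpa [enorm_eq_nnnorm, poissonAvg] using this

lemma tendsto_lintegral_sq_poissonAvg_sub {g : ℝ → ℂ} (hgm : Measurable g)
    (hg : MemLp g 2 stdCauchy) :
    Tendsto (fun y => ∫⁻ x, ‖poissonAvg g y x - g x‖ₑ ^ 2 ∂stdCauchy) (𝓝[>] 0) (𝓝 0) := by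
  have hgi : Integrable g stdCauchy := hg.integrable (by norm_num)
  have hfin : ∫⁻ x, ‖g x‖ₑ ^ 2 ∂stdCauchy ≠ ∞ := by
    have := hg.2
    rw [eLpNorm_two_sq] at this
    intro h
    rw [h] at this
    simp at this
  have := tendsto_modular_poissonAvg_sub stdCauchy_le (A := 2) (by simp)
    (fun y hy hy1 h hh => lintegral_lintegral_stdCauchy_le hh hy hy1) convexOn_sq_nnreal
    (by fun_prop) (fun a b h => pow_le_pow_left₀ zero_le h 2) (by simp) hgm hgi (fun K => by
      simp only [mul_pow, ENNReal.coe_mul]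
      rw [lintegral_const_mul _ (by fun_prop)]
      refine ENNReal.mul_ne_top ENNReal.coe_ne_top ?_
      simpa [enorm_eq_nnnorm] using hfin) 1
  simpa [enorm_eq_nnnorm] using this

/-- Boundary values, in the weak sense, of an analytic function whose horizontal traces are
bounded in `L¹` of the Cauchy distribution. -/
theorem exists_boundary_function {F : ℂ → ℂ} (hF : AnalyticOnNhd ℂ F upperHalf)
    (hbd : ∀ y₀ : ℝ, 0 < y₀ → ∃ M : ℝ, ∀ z : ℂ, y₀ ≤ z.im → ‖F z‖ ≤ M) {B : ℝ≥0}
    (hB : ∀ y : ℝ, 0 < y → ∫⁻ x, ‖slice F y x‖ₑ ∂stdCauchy ≤ B) :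
    ∃ f : ℝ → ℂ, Measurable f ∧ Integrable f stdCauchy ∧ ∃ (U : Ultrafilter ℕ) (e : ℕ → ℝ),
      (∀ n, 0 < e n) ∧ Tendsto e U (𝓝[>] 0) ∧ ∀ φ : ℝ → ℂ, Continuous φ →
        (∃ A : ℝ, ∀ t, ‖φ t‖ ≤ A) →
        Tendsto (fun n => ∫ x, slice F (e n) x * φ x ∂stdCauchy) U
          (𝓝 (∫ x, f x * φ x ∂stdCauchy)) := by
  set e : ℕ → ℝ := fun n => 1 / ((n : ℝ) + 1) with he
  have hepos : ∀ n, 0 < e n := fun n => by positivity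
  have he1 : ∀ n, e n ≤ 1 := fun n => by
    rw [he]
    simp only
    rw [div_le_one (by positivity)]
    linarith [(Nat.cast_nonneg n : (0 : ℝ) ≤ n)]
  let U : Ultrafilter ℕ := Filter.hyperfilter ℕ
  have heU : Tendsto e U (𝓝[>] 0) := by
    refine tendsto_nhdsWithin_iff.2 ⟨?_, Eventually.of_forall hepos⟩
    exact tendsto_one_div_add_atTop_nhds_zero_nat.mono_left Nat.hyperfilter_le_atTop
  -- the square roots
  set u : ℕ → ℝ → ℂ := fun n t => (Real.sqrt ‖slice F (e n) t‖ : ℂ) with hu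
  have hucont : ∀ n, Continuous (u n) := fun n => by
    have := slice_continuous hF (hepos n)
    fun_prop
  have hunorm : ∀ n, ∫⁻ x, ‖u n x‖ₑ ^ 2 ∂stdCauchy ≤ B := by
    intro n
    refine le_trans (le_of_eq (lintegral_congr fun x => ?_)) (hB (e n) (hepos n))
    rw [← ofReal_norm, ← ofReal_norm, ← ENNReal.ofReal_pow (norm_nonneg _), hu]
    simp only
    rw [Complex.norm_real, Real.norm_of_nonneg (Real.sqrt_nonneg _), Real.sq_sqrt (norm_nonneg _)]
  have hbound : ∀ {v : ℝ → ℂ} {D : ℝ≥0}, ∫⁻ x, ‖v x‖ₑ ^ 2 ∂stdCauchy ≤ D →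
      eLpNorm v 2 stdCauchy ≤ (D ^ (1 / 2 : ℝ) : ℝ≥0) := by
    intro v D h
    rw [eLpNorm_two_sq, ENNReal.coe_rpow_of_nonneg _ (by norm_num)]
    exact ENNReal.rpow_le_rpow h (by norm_num)
  obtain ⟨g, hgm, hg2, hgw⟩ := exists_weak_limit_memLp (μ := stdCauchy) U (u := u)
    (fun n => ⟨(hucont n).aestronglyMeasurable, (hbound (hunorm n)).trans_lt ENNReal.coe_lt_top⟩)
    (fun n => hbound (hunorm n))
  have hgi : Integrable g stdCauchy := hg2.integrable (by norm_num)
  have hslice_lim : ∀ (x : ℝ) {y : ℝ}, 0 < y →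
      Tendsto (fun n => slice F (y + e n) x) U (𝓝 (slice F y x)) := by
    intro x y hy
    have hc : ContinuousAt (fun h : ℝ => slice F (y + h) x) 0 := by
      unfold slice
      refine ContinuousAt.comp (f := fun h : ℝ => (x : ℂ) + ((y + h : ℝ) : ℂ) * Complex.I)
        (g := F) ?_ (by fun_prop)
      exact (hF _ (by simpa [upperHalf] using hy)).continuousAt
    have h1 := hc.tendsto.comp (heU.mono_right nhdsWithin_le_nhds)
    rw [add_zero] at h1
    exact h1
  -- The sub-mean value inequality survives the weak limit: at a fixed point, the Poisson average is
  -- a pairing with one `L²` test function.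
  have hsqrt : ∀ (x : ℝ) {y : ℝ}, 0 < y → Real.sqrt ‖slice F y x‖ ≤ ‖poissonAvg g y x‖ := by
    intro x y hy
    obtain ⟨A, hA⟩ := exists_norm_relKernel_le x hy
    have hlim := (hgw _ (memLp_two_of_bound (continuous_relKernel x hy) hA)).norm
    rw [← poissonAvg_eq_integral_relKernel g x hy] at hlim
    have hl := (Real.continuous_sqrt.tendsto _).comp (hslice_lim x hy).norm
    refine le_of_tendsto_of_tendsto' hl hlim fun n => ?_
    rw [← poissonAvg_eq_integral_relKernel (u n) x hy]
    exact sqrt_norm_slice_add_le hF hbd x hy (hepos n)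
  -- factorization of the traces
  set G : ℕ → ℝ → ℂ := fun n => poissonAvg g (e n) with hG
  have hGm : ∀ n, Measurable (G n) := fun n =>
    (stronglyMeasurable_poissonAvg hgm (e n)).measurable
  have hFG : ∀ n x, ‖slice F (e n) x‖ ≤ ‖G n x‖ ^ 2 := by
    intro n x
    have := hsqrt x (hepos n)
    rwa [Real.sqrt_le_left (norm_nonneg _)] at this
  set b : ℕ → ℝ → ℂ := fun n x => slice F (e n) x / G n x with hb
  have hbm : ∀ n, Measurable (b n) := fun n =>
    (slice_continuous hF (hepos n)).measurable.div (hGm n)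
  have hbG : ∀ n x, ‖b n x‖ ≤ ‖G n x‖ := by
    intro n x
    rw [hb]
    simp only [norm_div]
    refine div_le_of_le_mul₀ (norm_nonneg _) (norm_nonneg _) ?_
    rw [← sq]
    exact hFG n x
  -- Where `G n` vanishes the quotient is zero by convention, and `hFG` forces the trace to vanish
  -- as well.
  have hbmul : ∀ n x, slice F (e n) x = b n x * G n x := by
    intro n x
    by_cases h : G n x = 0
    · have := hFG n x
      rw [h, norm_zero] at this
      rw [h, mul_zero, ← norm_le_zero_iff]
      simpa using this
    · simp only [hb]
      rw [div_mul_cancel₀ _ h]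
  obtain ⟨D, hD⟩ : ∃ D : ℝ≥0, 2 * ∫⁻ x, ‖g x‖ₑ ^ 2 ∂stdCauchy = D := by
    refine ⟨(2 * ∫⁻ x, ‖g x‖ₑ ^ 2 ∂stdCauchy).toNNReal, (ENNReal.coe_toNNReal ?_).symm⟩
    refine ENNReal.mul_ne_top (by simp) fun h => ?_
    have := hg2.2
    rw [eLpNorm_two_sq, h] at this
    simp at this
  have hbD : ∀ n, ∫⁻ x, ‖b n x‖ₑ ^ 2 ∂stdCauchy ≤ D := by
    intro n
    rw [← hD]
    refine le_trans (lintegral_mono fun x => ?_)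
      (lintegral_sq_poissonAvg_le hgm hgi (hepos n) (he1 n))
    gcongr
    exact enorm_le_iff_norm_le.2 (hbG n x)
  have hb2 : ∀ n, MemLp (b n) 2 stdCauchy := fun n =>
    ⟨(hbm n).aestronglyMeasurable, (hbound (hbD n)).trans_lt ENNReal.coe_lt_top⟩
  obtain ⟨b', hbm', hb2', hbw⟩ := exists_weak_limit_memLp (μ := stdCauchy) U hb2
    (fun n => hbound (hbD n))
  -- The factors `b n` converge weakly to `b'` and `G n` strongly to `g`, so the product of the
  -- limits is the weak limit of the traces.
  refine ⟨fun x => b' x * g x, hbm'.mul hgm, hb2'.integrable_mul hg2, U, e, hepos, heU,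
    fun φ hφ ⟨A, hA⟩ => ?_⟩
  have hA0 : 0 ≤ A := (norm_nonneg _).trans (hA 0)
  have hgφ : MemLp (fun x => g x * φ x) 2 stdCauchy := by
    refine MemLp.of_le_mul (c := A) hg2 (hgm.mul hφ.measurable).aestronglyMeasurable
      (ae_of_all _ fun x => ?_)
    rw [norm_mul, mul_comm]
    exact mul_le_mul_of_nonneg_right (hA x) (norm_nonneg _)
  have hG2 : ∀ n, MemLp (G n) 2 stdCauchy := fun n =>
    ⟨(hGm n).aestronglyMeasurable, (hbound ((lintegral_sq_poissonAvg_le hgm hgi (hepos n)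
      (he1 n)).trans hD.le)).trans_lt ENNReal.coe_lt_top⟩
  have hd2 : ∀ n, MemLp (fun x => (G n x - g x) * φ x) 2 stdCauchy := fun n => by
    refine MemLp.of_le_mul (c := A) ((hG2 n).sub hg2)
      (((hGm n).sub hgm).mul hφ.measurable).aestronglyMeasurable (ae_of_all _ fun x => ?_)
    rw [norm_mul, mul_comm]
    exact mul_le_mul_of_nonneg_right (hA x) (norm_nonneg _)
  have hsplit : ∀ n, ∫ x, slice F (e n) x * φ x ∂stdCauchy =
      ∫ x, b n x * (g x * φ x) ∂stdCauchy + ∫ x, b n x * ((G n x - g x) * φ x) ∂stdCauchy := by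
    intro n
    have hi1 : Integrable (fun x => b n x * (g x * φ x)) stdCauchy := (hb2 n).integrable_mul hgφ
    have hi2 : Integrable (fun x => b n x * ((G n x - g x) * φ x)) stdCauchy :=
      (hb2 n).integrable_mul (hd2 n)
    rw [← integral_add hi1 hi2]
    congr 1
    ext x
    rw [hbmul]
    ring
  have herr : Tendsto (fun n => ∫ x, b n x * ((G n x - g x) * φ x) ∂stdCauchy) U (𝓝 0) := by
    have hE : Tendsto (fun n => ENNReal.ofReal A * ((D : ℝ≥0∞) ^ (1 / 2 : ℝ) *
        (∫⁻ x, ‖G n x - g x‖ₑ ^ 2 ∂stdCauchy) ^ (1 / 2 : ℝ))) U (𝓝 0) := by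
      have h1 := (tendsto_lintegral_sq_poissonAvg_sub hgm hg2).comp heU
      have h2 := ((ENNReal.continuous_rpow_const (y := (1 / 2 : ℝ))).tendsto _).comp h1
      rw [ENNReal.zero_rpow_of_pos (by norm_num)] at h2
      have h3 := ENNReal.Tendsto.const_mul (a := ENNReal.ofReal A)
        (ENNReal.Tendsto.const_mul (a := (D : ℝ≥0∞) ^ (1 / 2 : ℝ)) h2
        (Or.inr (ENNReal.rpow_ne_top_of_nonneg (by norm_num) ENNReal.coe_ne_top)))
        (Or.inr ENNReal.ofReal_ne_top)
      rwa [mul_zero, mul_zero] at h3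
    rw [tendsto_iff_edist_tendsto_0]
    refine tendsto_of_tendsto_of_tendsto_of_le_of_le tendsto_const_nhds hE (fun _ => zero_le)
      fun n => ?_
    simp only
    rw [edist_zero_right]
    calc ‖∫ x, b n x * ((G n x - g x) * φ x) ∂stdCauchy‖ₑ
        ≤ ∫⁻ x, ‖b n x * ((G n x - g x) * φ x)‖ₑ ∂stdCauchy := enorm_integral_le_lintegral_enorm _
      _ ≤ ∫⁻ x, ENNReal.ofReal A * (‖b n x‖ₑ * ‖G n x - g x‖ₑ) ∂stdCauchy := by
          refine lintegral_mono fun x => ?_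
          rw [enorm_mul, enorm_mul, mul_comm (ENNReal.ofReal A), ← mul_assoc]
          gcongr
          rw [← ofReal_norm]
          exact ENNReal.ofReal_le_ofReal (hA x)
      _ = ENNReal.ofReal A * ∫⁻ x, ‖b n x‖ₑ * ‖G n x - g x‖ₑ ∂stdCauchy :=
          lintegral_const_mul' _ _ ENNReal.ofReal_ne_top
      _ ≤ _ := by
          gcongr
          have hh := ENNReal.lintegral_mul_le_Lp_mul_Lq stdCauchy
            (Real.holderConjugate_iff.2 ⟨by norm_num, by norm_num⟩ :
              Real.HolderConjugate 2 2)
            (f := fun x => ‖b n x‖ₑ) (g := fun x => ‖G n x - g x‖ₑ)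
            (hbm n).enorm.aemeasurable ((hGm n).sub hgm).enorm.aemeasurable
          simp only [ENNReal.rpow_ofNat] at hh
          refine hh.trans ?_
          gcongr
          exact hbD n
  have hmain := (hbw _ hgφ).add herr
  rw [add_zero] at hmain
  simp_rw [hsplit, mul_assoc]
  exact hmain

/-! ### Cauchy kernels and the Poisson representation. -/

lemma abs_im_le_norm_sub (t : ℝ) (w : ℂ) : |w.im| ≤ ‖(t : ℂ) - w‖ := by
  have := Complex.abs_im_le_norm ((t : ℂ) - w)
  simpa using this

lemma ofReal_sub_ne_zero {w : ℂ} (hw : w.im ≠ 0) (t : ℝ) : (t : ℂ) - w ≠ 0 := by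
  intro h
  have := abs_im_le_norm_sub t w
  rw [h, norm_zero] at this
  exact hw (abs_nonpos_iff.1 this)

lemma norm_add_one_le_mul_norm_sub {w z : ℂ} {d : ℝ} (hd : 0 < d) (h : d ≤ ‖z - w‖) :
    ‖z‖ + 1 ≤ (1 + (‖w‖ + 1) / d) * ‖z - w‖ := by
  have h1 : ‖z‖ ≤ ‖z - w‖ + ‖w‖ := by simpa using norm_add_le (z - w) w
  have h2 : ‖w‖ + 1 ≤ (‖w‖ + 1) / d * ‖z - w‖ := by
    rw [div_mul_eq_mul_div, le_div_iff₀ hd]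
    exact mul_le_mul_of_nonneg_left h (by positivity)
  linarith

lemma norm_one_add_sq_div_le {w w' z : ℂ} {d : ℝ} (hd : 0 < d) (h : d ≤ ‖z - w‖)
    (h' : d ≤ ‖z - w'‖) : ‖(1 + z ^ 2) / ((z - w) * (z - w'))‖ ≤
      (1 + (‖w‖ + 1) / d) * (1 + (‖w'‖ + 1) / d) := by
  have h1 := norm_add_one_le_mul_norm_sub hd h
  have h2 := norm_add_one_le_mul_norm_sub hd h'
  have h3 : 0 < ‖z - w‖ := hd.trans_le h
  have h4 : 0 < ‖z - w'‖ := hd.trans_le h'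
  rw [norm_div, norm_mul, div_le_iff₀ (by positivity)]
  calc ‖1 + z ^ 2‖ ≤ 1 + ‖z‖ ^ 2 := by
        refine (norm_add_le _ _).trans ?_
        rw [norm_one, norm_pow]
    _ ≤ (‖z‖ + 1) * (‖z‖ + 1) := by nlinarith [norm_nonneg z]
    _ ≤ ((1 + (‖w‖ + 1) / d) * ‖z - w‖) * ((1 + (‖w'‖ + 1) / d) * ‖z - w'‖) := by gcongr
    _ = _ := by ring

/-- The weak boundary function represents `F` as a Poisson integral and has vanishing
second-order Cauchy integrals in the lower half-plane. -/
theorem exists_poisson_representation {F : ℂ → ℂ} (hF : AnalyticOnNhd ℂ F upperHalf)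
    (hbd : ∀ y₀ : ℝ, 0 < y₀ → ∃ M : ℝ, ∀ z : ℂ, y₀ ≤ z.im → ‖F z‖ ≤ M) {B : ℝ≥0}
    (hB : ∀ y : ℝ, 0 < y → ∫⁻ x, ‖slice F y x‖ₑ ∂stdCauchy ≤ B) :
    ∃ f : ℝ → ℂ, Measurable f ∧ Integrable f stdCauchy ∧
      (∀ y : ℝ, 0 < y → ∀ x, slice F y x = poissonAvg f y x) ∧
      ∀ w w' : ℂ, w.im < 0 → w'.im < 0 →
        ∫ t : ℝ, f t * (1 / (((t : ℂ) - w) * ((t : ℂ) - w'))) = 0 := by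
  obtain ⟨f, hfm, hfi, U, e, hepos, heU, hlim⟩ := exists_boundary_function hF hbd hB
  refine ⟨f, hfm, hfi, fun y hy x => ?_, fun w w' hw hw' => ?_⟩
  · have h1 := hlim (relKernel x y) (continuous_relKernel x hy) (exists_norm_relKernel_le x hy)
    rw [← poissonAvg_eq_integral_relKernel f x hy] at h1
    have hc : ContinuousAt (fun h : ℝ => slice F (y + h) x) 0 := by
      unfold slice
      refine ContinuousAt.comp (f := fun h : ℝ => (x : ℂ) + ((y + h : ℝ) : ℂ) * Complex.I)
        (g := F) ?_ (by fun_prop)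
      exact (hF _ (by simpa [upperHalf] using hy)).continuousAt
    have h2 := hc.tendsto.comp (heU.mono_right nhdsWithin_le_nhds)
    rw [add_zero] at h2
    refine tendsto_nhds_unique h2 (h1.congr fun n => ?_)
    rw [← poissonAvg_eq_integral_relKernel _ x hy, ← slice_add_eq_poissonAvg hF hbd x hy (hepos n)]
    rfl
  -- The numerator `1 + z²` cancels the Cauchy density and vanishes at `i`, the point at which the
  -- mean value property evaluates; hence every trace integrates to zero against `φ`.
  · set φ : ℂ → ℂ := fun z => (1 + z ^ 2) / ((z - w) * (z - w')) with hφ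
    set d : ℝ := min (-w.im) (-w'.im) with hd
    have hd0 : 0 < d := lt_min (by linarith) (by linarith)
    have hdw : ∀ z : ℂ, 0 ≤ z.im → d ≤ ‖z - w‖ ∧ d ≤ ‖z - w'‖ := by
      intro z hz
      constructor
      · refine (min_le_left _ _).trans ((le_trans ?_ (Complex.im_le_norm _)))
        simp; linarith
      · refine (min_le_right _ _).trans ((le_trans ?_ (Complex.im_le_norm _)))
        simp; linarith
    have hne : ∀ z : ℂ, 0 ≤ z.im → (z - w) * (z - w') ≠ 0 := fun z hz =>
      mul_ne_zero (norm_pos_iff.1 (hd0.trans_le (hdw z hz).1))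
        (norm_pos_iff.1 (hd0.trans_le (hdw z hz).2))
    set A := (1 + (‖w‖ + 1) / d) * (1 + (‖w'‖ + 1) / d) with hA
    have hφA : ∀ z : ℂ, 0 ≤ z.im → ‖φ z‖ ≤ A := fun z hz =>
      norm_one_add_sq_div_le hd0 (hdw z hz).1 (hdw z hz).2
    have hφc : ContinuousOn φ {z | 0 ≤ z.im} :=
      ContinuousOn.div (by fun_prop) (by fun_prop) fun z hz => hne z hz
    have h1 := hlim (fun t : ℝ => φ t)
      (hφc.comp_continuous Complex.continuous_ofReal fun t => by simp)
      ⟨A, fun t => hφA t (by simp)⟩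
    have h0 : ∀ n, ∫ x : ℝ, slice F (e n) x * φ x ∂stdCauchy = 0 := by
      intro n
      obtain ⟨M, hM⟩ := hbd (e n) (hepos n)
      obtain ⟨r1, r2⟩ := shift_regular hF 0 one_pos (hepos n)
      have hb1 : ∀ z : ℂ, 0 ≤ z.im →
          ‖F (((0 : ℝ) : ℂ) + ((1 : ℝ) : ℂ) * z + e n * Complex.I)‖ ≤ M := fun z hz =>
        hM _ (by simp [hz])
      have hM0 : 0 ≤ M := (norm_nonneg _).trans (hb1 0 (by simp))
      have := apply_I_eq_integral
        (G := fun z => F (((0 : ℝ) : ℂ) + ((1 : ℝ) : ℂ) * z + e n * Complex.I) * φ z)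
        (B := M * A) (r1.mul fun z hz => by
          have := hne z (le_of_lt hz)
          rw [hφ]
          exact AnalyticAt.fun_div (by fun_prop) (by fun_prop) this)
        (r2.mul hφc) fun z hz => by
          rw [norm_mul]
          exact mul_le_mul (hb1 z hz) (hφA z hz) (norm_nonneg _) hM0
      have hI : φ Complex.I = 0 := by simp [hφ]
      rw [hI, mul_zero] at this
      rw [this]
      congr 1
      ext t
      simp [slice]
    simp_rw [h0] at h1
    have h2 := tendsto_nhds_unique h1 tendsto_const_nhds
    rw [integral_stdCauchy] at h2
    have h3 : ∀ t : ℝ, (Real.pi⁻¹ * (1 + t ^ 2)⁻¹) • (f t * φ t) =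
        (Real.pi : ℂ)⁻¹ * (f t * (1 / (((t : ℂ) - w) * ((t : ℂ) - w')))) := by
      intro t
      have : (1 + (t : ℂ) ^ 2) ≠ 0 := by
        have : (1 + t ^ 2) ≠ 0 := by positivity
        exact_mod_cast this
      rw [Complex.real_smul, hφ]
      push_cast
      field_simp
    simp_rw [h3] at h2
    rw [integral_const_mul] at h2
    exact (mul_eq_zero.1 h2).resolve_left (by simp [Real.pi_ne_zero])

/-! ### Pointwise bounds from area means. -/

lemma enorm_le_lintegral_circle {F : ℂ → ℂ} {z : ℂ} {s : ℝ} (hs : 0 < s)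
    (hF : DifferentiableOn ℂ F (Metric.closedBall z s)) :
    ENNReal.ofReal (2 * Real.pi) * ‖F z‖ₑ ≤
      ∫⁻ θ in Set.Ioo (-Real.pi) Real.pi, ‖F (circleMap z s θ)‖ₑ := by
  have hd : DiffContOnCl ℂ F (Metric.ball z |s|) := by
    rw [abs_of_pos hs]
    exact hF.diffContOnCl_ball subset_rfl
  have h := hd.circleAverage
  rw [Real.circleAverage_eq_integral_add (-Real.pi),
    intervalIntegral.integral_comp_add_right (fun θ => F (circleMap z s θ)),
    intervalIntegral.integral_of_le (by linarith [Real.pi_pos]),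
    integral_Ioc_eq_integral_Ioo, zero_add, show 2 * Real.pi + -Real.pi = Real.pi by ring,
    inv_smul_eq_iff₀ (by positivity)] at h
  have h2 := enorm_integral_le_lintegral_enorm (μ := volume.restrict (Set.Ioo (-Real.pi) Real.pi))
    (fun θ => F (circleMap z s θ))
  rw [h, enorm_smul, Real.enorm_of_nonneg (by positivity)] at h2
  exact h2

lemma lintegral_ofReal_Ioo {r : ℝ} (hr : 0 < r) :
    ∫⁻ s in Set.Ioo 0 r, ENNReal.ofReal s = ENNReal.ofReal (r ^ 2 / 2) := by
  rw [← ofReal_integral_eq_lintegral_ofReal, ← integral_Ioc_eq_integral_Ioo,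
    ← intervalIntegral.integral_of_le hr.le, integral_id]
  · congr 1; ring
  · exact (continuous_id.integrableOn_Icc).mono_set Set.Ioo_subset_Icc_self
  · filter_upwards [ae_restrict_mem measurableSet_Ioo] with s hs using hs.1.le

/-- The circle mean inequality, integrated over radii with the polar weight `s`, bounds `|F z|`
times the disc area `π r²` by the integral of `|F|` over the disc. Enlarging the disc to a square
lets the bound on horizontal segments be integrated in height. -/
lemma enorm_mul_le_of_strip {F : ℂ → ℂ} (hF : AnalyticOnNhd ℂ F upperHalf) {z : ℂ} {r : ℝ}
    (hr : 0 < r) (hrz : r < z.im) {N : ℝ≥0∞}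
    (hN : ∀ b ∈ Set.Ioo (-r) r,
      ∫⁻ a in Set.Ioo (-r) r, ‖slice F (z.im + b) (z.re + a)‖ₑ ≤ N) :
    ENNReal.ofReal (r ^ 2 / 2) * (ENNReal.ofReal (2 * Real.pi) * ‖F z‖ₑ) ≤
      N * ENNReal.ofReal (2 * r) := by
  have hsub : ∀ w : ℂ, ‖w‖ ≤ r → z + w ∈ upperHalf := by
    intro w hw
    have := (abs_le.1 ((Complex.abs_im_le_norm w).trans hw)).1
    change 0 < (z + w).im
    rw [Complex.add_im]
    linarith
  set H : ℂ → ℝ≥0∞ := (Metric.ball (0 : ℂ) r).indicator fun w => ‖F (z + w)‖ₑ with hH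
  have hHm : Measurable H := by
    classical
    rw [hH, ← Set.piecewise_eq_indicator]
    refine ContinuousOn.measurable_piecewise ?_ continuousOn_const
      Metric.isOpen_ball.measurableSet
    refine continuous_enorm.comp_continuousOn (hF.continuousOn.comp
      (continuous_const.add continuous_id).continuousOn fun w hw => ?_)
    exact hsub w (by simpa using (Metric.mem_ball.1 hw).le)
  have lower : ENNReal.ofReal (r ^ 2 / 2) * (ENNReal.ofReal (2 * Real.pi) * ‖F z‖ₑ) ≤
      ∫⁻ w, H w := by
    rw [← Complex.lintegral_comp_polarCoord_symm, polarCoord_target, Measure.volume_eq_prod,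
      ← Measure.prod_restrict]
    simp only [Complex.polarCoord_symm_apply, smul_eq_mul]
    rw [lintegral_prod _ (Measurable.aemeasurable (by fun_prop)), ← lintegral_ofReal_Ioo hr,
      ← lintegral_mul_const _ (by fun_prop)]
    refine le_trans ?_ (lintegral_mono_set (Set.Ioo_subset_Ioi_self : Set.Ioo 0 r ⊆ Set.Ioi 0))
    refine setLIntegral_mono' measurableSet_Ioo fun s hs => ?_
    rw [lintegral_const_mul' _ _ ENNReal.ofReal_ne_top]
    gcongr
    refine (enorm_le_lintegral_circle hs.1 (F := F) (z := z) fun w hw => ?_).trans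
      (lintegral_mono fun θ => ?_)
    · refine (hF w ?_).differentiableAt.differentiableWithinAt
      have := hsub (w - z) ((mem_closedBall_iff_norm.1 hw).trans hs.2.le)
      rwa [add_sub_cancel] at this
    · have e : (s : ℂ) * (Real.cos θ + Real.sin θ * Complex.I) ∈ Metric.ball (0 : ℂ) r := by
        have h1 : (Real.cos θ + Real.sin θ * Complex.I : ℂ) = Complex.exp (θ * Complex.I) := by
          rw [Complex.exp_mul_I]; push_cast; rfl
        rw [mem_ball_zero_iff, norm_mul, h1, Complex.norm_exp_ofReal_mul_I, mul_one,
          Complex.norm_real, Real.norm_of_nonneg hs.1.le]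
        exact hs.2
      rw [hH]
      simp only
      rw [Set.indicator_of_mem e, circleMap, Complex.exp_mul_I]
      push_cast
      exact le_rfl
  refine lower.trans ?_
  rw [← (Complex.volume_preserving_equiv_real_prod.symm).lintegral_comp hHm,
    Measure.volume_eq_prod,
    lintegral_prod_symm (fun p => H (Complex.measurableEquivRealProd.symm p))
      (hHm.comp Complex.measurableEquivRealProd.symm.measurable).aemeasurable]
  have hpt : ∀ a b : ℝ, H (Complex.measurableEquivRealProd.symm (a, b)) ≤
      (Set.Ioo (-r) r).indicator (fun b => (Set.Ioo (-r) r).indicator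
        (fun a => ‖slice F (z.im + b) (z.re + a)‖ₑ) a) b := by
    intro a b
    by_cases hab : Complex.measurableEquivRealProd.symm (a, b) ∈ Metric.ball (0 : ℂ) r
    · have hab' := mem_ball_zero_iff.1 hab
      have ha : a ∈ Set.Ioo (-r) r := abs_lt.1 ((Complex.abs_re_le_norm _).trans_lt hab')
      have hb : b ∈ Set.Ioo (-r) r := abs_lt.1 ((Complex.abs_im_le_norm _).trans_lt hab')
      rw [Set.indicator_of_mem hb, Set.indicator_of_mem ha, hH,
        Set.indicator_of_mem hab, slice]
      refine le_of_eq ?_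
      congr 2
      apply Complex.ext <;> simp
    · rw [hH, Set.indicator_of_notMem hab]
      exact zero_le
  calc ∫⁻ b, ∫⁻ a, H (Complex.measurableEquivRealProd.symm (a, b))
      ≤ ∫⁻ b, (Set.Ioo (-r) r).indicator (fun _ => N) b := by
        refine lintegral_mono fun b => (lintegral_mono fun a => hpt a b).trans ?_
        by_cases hb : b ∈ Set.Ioo (-r) r
        · simp only [Set.indicator_of_mem hb]
          rw [lintegral_indicator measurableSet_Ioo]
          exact hN b hb
        · simp [Set.indicator_of_notMem hb]
    _ = N * ENNReal.ofReal (2 * r) := by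
        rw [lintegral_indicator measurableSet_Ioo, lintegral_const, Measure.restrict_apply_univ,
          Real.volume_Ioo]
        congr 2; ring

/-! ### Growth functions and modulars -/

variable {Φ : ℝ≥0 → ℝ≥0}

lemma IsGrowthFunction.map_zero (h : IsGrowthFunction Φ) : Φ 0 = 0 := by
  obtain ⟨a, ha⟩ := h.surjective 0
  exact le_antisymm ((h.monotone (zero_le : 0 ≤ a)).trans_eq ha) zero_le

/-- If `Φ s = 0`, the upper type inequality makes `Φ` vanish at all larger points, contradicting
surjectivity. -/
lemma MemClassUq.pos {q : ℝ} (h : MemClassUq q Φ) {s : ℝ≥0} (hs : 0 < s) : 0 < Φ s := by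
  rw [pos_iff_ne_zero]
  intro h0
  obtain ⟨C, -, hC⟩ := h.upperType
  obtain ⟨a, ha⟩ := h.growth.surjective 1
  have h1 := hC s hs (max 1 (a / s)) (le_max_left _ _)
  rw [h0, mul_zero] at h1
  have h2 : a ≤ s * max 1 (a / s) := by
    calc a = s * (a / s) := by field_simp
      _ ≤ _ := by gcongr; exact le_max_right _ _
  have h3 := (h.growth.monotone h2).trans h1
  rw [ha] at h3
  exact absurd h3 (by simp)

/-- Monotonicity of `Φ t / t` gives `Φ t ≥ Φ 1 * t` for `t ≥ 1`. Hence a modular bound yields an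
`L¹` bound on finite measure spaces. -/
lemma MemClassUq.le_one_add {q : ℝ} (h : MemClassUq q Φ) (t : ℝ≥0) : t ≤ 1 + Φ t / Φ 1 := by
  rcases le_total t 1 with ht | ht
  · exact ht.trans (le_add_of_nonneg_right zero_le)
  · have h1 := h.monotoneOn_div (Set.mem_Ioi.2 one_pos)
      (Set.mem_Ioi.2 (lt_of_lt_of_le one_pos ht)) ht
    simp only [div_one] at h1
    have hp := h.pos one_pos
    refine le_trans ?_ (le_add_of_nonneg_left zero_le)
    rw [le_div_iff₀ hp]
    rwa [le_div_iff₀ (lt_of_lt_of_le one_pos ht), mul_comm] at h1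

lemma MemClassUq.lintegral_enorm_le {q : ℝ} (h : MemClassUq q Φ) {α : Type*} [MeasurableSpace α]
    {μ : Measure α} {f : α → ℂ} (hf : Measurable f) {c : ℝ≥0} (hc : 0 < c)
    (hmod : ∫⁻ x, (Φ (‖f x‖₊ / c) : ℝ≥0∞) ∂μ ≤ 1) :
    ∫⁻ x, ‖f x‖ₑ ∂μ ≤ c * (μ Set.univ + (Φ 1 : ℝ≥0∞)⁻¹) := by
  have hp := h.pos one_pos
  have hpt : ∀ x, ‖f x‖ₑ ≤ c * (1 + (Φ 1 : ℝ≥0∞)⁻¹ * Φ (‖f x‖₊ / c)) := by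
    intro x
    have h1 := mul_le_mul_right (h.le_one_add (‖f x‖₊ / c)) c
    rw [mul_div_cancel₀ _ hc.ne'] at h1
    rw [enorm_eq_nnnorm, ← ENNReal.coe_inv hp.ne']
    rw [div_eq_inv_mul (Φ (‖f x‖₊ / c))] at h1
    exact_mod_cast h1
  have hm : Measurable fun x => (Φ (‖f x‖₊ / c) : ℝ≥0∞) := by
    have := h.growth.continuous.measurable
    fun_prop
  calc ∫⁻ x, ‖f x‖ₑ ∂μ ≤ ∫⁻ x, c * (1 + (Φ 1 : ℝ≥0∞)⁻¹ * Φ (‖f x‖₊ / c)) ∂μ :=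
        lintegral_mono hpt
    _ = c * (μ Set.univ + (Φ 1 : ℝ≥0∞)⁻¹ * ∫⁻ x, (Φ (‖f x‖₊ / c) : ℝ≥0∞) ∂μ) := by
        rw [lintegral_const_mul _ (by fun_prop), lintegral_add_left (by fun_prop),
          lintegral_const_mul _ hm, lintegral_one]
    _ ≤ _ := by
        gcongr
        exact mul_le_of_le_one_right' hmod

lemma exists_modular_le_of_luxNorm_lt (hm : Monotone Φ) {f : ℝ → ℂ} {c : ℝ≥0}
    (h : luxNorm Φ f < c) : ∫⁻ x : ℝ, (Φ (‖f x‖₊ / c) : ℝ≥0∞) ≤ 1 := by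
  simp only [luxNorm, iInf_lt_iff] at h
  obtain ⟨d, hd, hd1, hdc⟩ := h
  refine (lintegral_mono fun x => ?_).trans hd1
  refine ENNReal.coe_le_coe.2 (hm ?_)
  have : d ≤ c := (ENNReal.coe_lt_coe.1 hdc).le
  gcongr

lemma luxNorm_le {f : ℝ → ℂ} {c : ℝ≥0} (hc : 0 < c)
    (h : ∫⁻ x : ℝ, (Φ (‖f x‖₊ / c) : ℝ≥0∞) ≤ 1) : luxNorm Φ f ≤ c :=
  iInf_le_of_le c (iInf_le_of_le hc (iInf_le _ h))

lemma luxNorm_le_hardyNorm (F : ℂ → ℂ) {y : ℝ} (hy : 0 < y) :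
    luxNorm Φ (slice F y) ≤ hardyNorm Φ F :=
  le_iSup₂ (f := fun (y : ℝ) (_ : 0 < y) => luxNorm Φ (slice F y)) y hy

lemma exists_modular_slice_le (hm : Monotone Φ) {F : ℂ → ℂ} (h : hardyNorm Φ F < ∞) :
    ∃ c : ℝ≥0, 0 < c ∧ ∀ y : ℝ, 0 < y → ∫⁻ x : ℝ, (Φ (‖slice F y x‖₊ / c) : ℝ≥0∞) ≤ 1 := by
  refine ⟨(hardyNorm Φ F).toNNReal + 1, by positivity, fun y hy =>
    exists_modular_le_of_luxNorm_lt hm ((luxNorm_le_hardyNorm F hy).trans_lt ?_)⟩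
  rw [ENNReal.coe_add, ENNReal.coe_toNNReal h.ne]
  exact ENNReal.lt_add_right h.ne one_ne_zero

lemma MemClassUq.exists_lintegral_slice_le {q : ℝ} (h : MemClassUq q Φ) {F : ℂ → ℂ}
    (hF : AnalyticOnNhd ℂ F upperHalf) {c : ℝ≥0} (hc : 0 < c)
    (hmod : ∀ y : ℝ, 0 < y → ∫⁻ x : ℝ, (Φ (‖slice F y x‖₊ / c) : ℝ≥0∞) ≤ 1) :
    ∃ B : ℝ≥0, ∀ y : ℝ, 0 < y → ∫⁻ x, ‖slice F y x‖ₑ ∂stdCauchy ≤ B := by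
  have hp := h.pos one_pos
  refine ⟨c * (1 + (Φ 1)⁻¹), fun y hy => ?_⟩
  refine (h.lintegral_enorm_le (slice_continuous hF hy).measurable hc
    ((lintegral_mono' stdCauchy_le le_rfl).trans (hmod y hy))).trans (le_of_eq ?_)
  rw [measure_univ, ← ENNReal.coe_inv hp.ne']
  push_cast
  rfl

/-- With `r = y₀ / 2` the square around `z` stays in the half-plane, and the modular bounds `|F|` in
`L¹` on each horizontal segment of length `2r`, uniformly in `z`. -/
lemma MemClassUq.exists_norm_le {q : ℝ} (h : MemClassUq q Φ) {F : ℂ → ℂ}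
    (hF : AnalyticOnNhd ℂ F upperHalf) {c : ℝ≥0} (hc : 0 < c)
    (hmod : ∀ y : ℝ, 0 < y → ∫⁻ x : ℝ, (Φ (‖slice F y x‖₊ / c) : ℝ≥0∞) ≤ 1)
    {y₀ : ℝ} (hy₀ : 0 < y₀) : ∃ M : ℝ, ∀ z : ℂ, y₀ ≤ z.im → ‖F z‖ ≤ M := by
  have hp := h.pos one_pos
  set r := y₀ / 2 with hr
  have hr0 : 0 < r := by positivity
  set N : ℝ≥0∞ := c * (ENNReal.ofReal (r - -r) + (Φ 1 : ℝ≥0∞)⁻¹) with hN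
  have hNtop : N ≠ ∞ := by
    refine ENNReal.mul_ne_top ENNReal.coe_ne_top (ENNReal.add_ne_top.2 ⟨ENNReal.ofReal_ne_top, ?_⟩)
    simpa using hp.ne'
  have key : ∀ z : ℂ, y₀ ≤ z.im →
      ENNReal.ofReal (r ^ 2 / 2) * (ENNReal.ofReal (2 * Real.pi) * ‖F z‖ₑ) ≤
        N * ENNReal.ofReal (2 * r) := by
    intro z hz
    refine enorm_mul_le_of_strip hF hr0 (by linarith) fun b hb => ?_
    have hyb : 0 < z.im + b := by linarith [hb.1]
    have := h.lintegral_enorm_le (μ := volume.restrict (Set.Ioo (-r) r))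
      (f := fun a => slice F (z.im + b) (z.re + a))
      ((slice_continuous hF hyb).comp (by fun_prop)).measurable hc
      ((setLIntegral_le_lintegral _ _).trans (by
        rw [lintegral_add_left_eq_self
          (fun a => (Φ (‖slice F (z.im + b) a‖₊ / c) : ℝ≥0∞)) z.re]
        exact hmod _ hyb))
    rwa [Measure.restrict_apply_univ, Real.volume_Ioo] at this
  refine ⟨(r ^ 2 / 2)⁻¹ * (2 * Real.pi)⁻¹ * (N * ENNReal.ofReal (2 * r)).toReal, fun z hz => ?_⟩
  have h1 := ENNReal.toReal_mono (ENNReal.mul_ne_top hNtop ENNReal.ofReal_ne_top) (key z hz)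
  rw [ENNReal.toReal_mul, ENNReal.toReal_mul, ENNReal.toReal_ofReal (by positivity),
    ENNReal.toReal_ofReal (by positivity), toReal_enorm] at h1
  rw [mul_assoc, ← div_eq_inv_mul, ← div_eq_inv_mul, le_div_iff₀ (by positivity),
    le_div_iff₀ (by positivity)]
  linarith

lemma tendsto_lintegral_enorm_poissonAvg_sub {f : ℝ → ℂ} (hfm : Measurable f)
    (hfi : Integrable f stdCauchy) :
    Tendsto (fun y => ∫⁻ x, ‖poissonAvg f y x - f x‖ₑ ∂stdCauchy) (𝓝[>] 0) (𝓝 0) := by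
  have := tendsto_modular_poissonAvg_sub stdCauchy_le (A := 2) (by simp)
    (fun y hy hy1 h hh => lintegral_lintegral_stdCauchy_le hh hy hy1) (Ψ := id)
    (convexOn_id convex_univ) continuous_id monotone_id rfl hfm hfi (fun K => by
      simp only [id, ENNReal.coe_mul]
      rw [lintegral_const_mul _ (by fun_prop)]
      exact ENNReal.mul_ne_top ENNReal.coe_ne_top hfi.2.ne) 1
  simpa [enorm_eq_nnnorm] using this

/-- Fatou's lemma for the modulars of Poisson averages. -/
lemma modular_le_of_poissonAvg (hcont : Continuous Φ) {f : ℝ → ℂ} (hfm : Measurable f)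
    (hfi : Integrable f stdCauchy) {c : ℝ≥0}
    (h : ∀ y : ℝ, 0 < y → ∫⁻ x : ℝ, (Φ (‖poissonAvg f y x‖₊ / c) : ℝ≥0∞) ≤ 1) :
    ∫⁻ x : ℝ, (Φ (‖f x‖₊ / c) : ℝ≥0∞) ≤ 1 := by
  set e : ℕ → ℝ := fun n => 1 / ((n : ℝ) + 1) with he
  have hepos : ∀ n, 0 < e n := fun n => by positivity
  have he0 : Tendsto e atTop (𝓝[>] 0) :=
    tendsto_nhdsWithin_iff.2 ⟨tendsto_one_div_add_atTop_nhds_zero_nat, Eventually.of_forall hepos⟩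
  -- `L¹` convergence for the Cauchy distribution supplies an almost everywhere convergent
  -- subsequence, also for Lebesgue measure since the latter is absolutely continuous with respect
  -- to the former.
  have hm : TendstoInMeasure stdCauchy (fun n => poissonAvg f (e n)) atTop f := by
    refine tendstoInMeasure_of_tendsto_eLpNorm (p := 1) one_ne_zero
      (fun n => (stronglyMeasurable_poissonAvg hfm (e n)).aestronglyMeasurable)
      hfm.aestronglyMeasurable ?_
    simp_rw [eLpNorm_one_eq_lintegral_enorm]
    exact (tendsto_lintegral_enorm_poissonAvg_sub hfm hfi).comp he0
  obtain ⟨ns, -, hns⟩ := hm.exists_seq_tendsto_ae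
  have hns' := ac_stdCauchy.ae_le hns
  have hΦm := hcont.measurable
  calc ∫⁻ x : ℝ, (Φ (‖f x‖₊ / c) : ℝ≥0∞)
      = ∫⁻ x : ℝ, liminf (fun n => (Φ (‖poissonAvg f (e (ns n)) x‖₊ / c) : ℝ≥0∞)) atTop := by
        refine lintegral_congr_ae ?_
        filter_upwards [hns'] with x hx
        refine (Tendsto.liminf_eq ?_).symm
        refine ENNReal.tendsto_coe.2 ((hcont.tendsto _).comp ?_)
        exact hx.nnnorm.div_const c
    _ ≤ liminf (fun n => ∫⁻ x : ℝ, (Φ (‖poissonAvg f (e (ns n)) x‖₊ / c) : ℝ≥0∞)) atTop := by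
        refine lintegral_liminf_le fun n => ?_
        have := (stronglyMeasurable_poissonAvg hfm (e (ns n))).measurable
        fun_prop
    _ ≤ 1 := by
        refine liminf_le_of_le (by isBoundedDefault) fun b hb => ?_
        obtain ⟨n, hn⟩ := hb.exists
        exact hn.trans (h _ (hepos _))

/-- Upper type acts as a doubling condition: finiteness at one dilation passes to every dilation. -/
lemma MemClassUq.modular_ne_top {q : ℝ} (h : MemClassUq q Φ) {f : ℝ → ℂ} {c : ℝ≥0}
    (hc : 0 < c) (hmod : ∫⁻ x : ℝ, (Φ (‖f x‖₊ / c) : ℝ≥0∞) ≤ 1) (K : ℝ≥0) :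
    ∫⁻ x : ℝ, (Φ (K * ‖f x‖₊) : ℝ≥0∞) ≠ ∞ := by
  obtain ⟨C, -, hC⟩ := h.upperType
  set D : ℝ≥0 := C * (max 1 (K * c)) ^ q with hD
  have hpt : ∀ x, (Φ (K * ‖f x‖₊) : ℝ≥0∞) ≤ D * Φ (‖f x‖₊ / c) := by
    intro x
    rcases eq_or_ne (‖f x‖₊) 0 with h0 | h0
    · rw [h0, mul_zero, h.growth.map_zero]; simp
    · have h1 := hC (‖f x‖₊ / c) (div_pos (pos_iff_ne_zero.2 h0) hc) (max 1 (K * c))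
        (le_max_left _ _)
      have h2 : K * ‖f x‖₊ ≤ ‖f x‖₊ / c * max 1 (K * c) := by
        calc K * ‖f x‖₊ = ‖f x‖₊ / c * (K * c) := by field_simp
          _ ≤ _ := by gcongr; exact le_max_right _ _
      exact_mod_cast (h.growth.monotone h2).trans h1
  refine ne_top_of_le_ne_top ?_ (lintegral_mono hpt)
  rw [lintegral_const_mul' _ _ ENNReal.coe_ne_top]
  exact ENNReal.mul_ne_top ENNReal.coe_ne_top (ne_top_of_le_ne_top ENNReal.one_ne_top hmod)

/-- A Young-type inequality for functions of upper type. -/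
lemma MemClassUq.young {q : ℝ} (hq : 1 ≤ q) (h : MemClassUq q Φ) (κ₀ : ℝ≥0) :
    ∃ D : ℝ≥0, ∀ a κ : ℝ≥0, κ ≤ κ₀ → a * κ ≤ D * Φ a + κ ^ ((q + 1) / q) := by
  obtain ⟨C, -, hC⟩ := h.upperType
  have hp := h.pos one_pos
  have hq0 : 0 < q := by linarith
  -- The first constant serves `a ≥ 1`, where `Φ a ≥ Φ 1 * a`. The second serves `a ≤ 1`, where
  -- Young's inequality with exponents `q + 1` and `(q + 1) / q` is combined with `a^(q+1) ≤ a^q ≤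
  -- (C / Φ 1) Φ a`, upper type being applied between `a` and `1`.
  refine ⟨max (κ₀ * (1 / Φ 1)) (C / Φ 1), fun a κ hκ => ?_⟩
  rcases le_total 1 a with ha | ha
  · refine le_trans ?_ (le_add_of_nonneg_right zero_le)
    have h1 : a ≤ Φ a / Φ 1 := by
      have h1 := h.monotoneOn_div (Set.mem_Ioi.2 one_pos)
        (Set.mem_Ioi.2 (lt_of_lt_of_le one_pos ha)) ha
      simp only [div_one] at h1
      rw [le_div_iff₀ hp]
      rwa [le_div_iff₀ (lt_of_lt_of_le one_pos ha), mul_comm] at h1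
    calc a * κ ≤ Φ a / Φ 1 * κ₀ := by gcongr
      _ = κ₀ * (1 / Φ 1) * Φ a := by ring
      _ ≤ _ := by
        gcongr
        exact le_max_left _ _
  · rcases eq_or_ne a 0 with rfl | ha0
    · simp
    have hapos : 0 < a := pos_iff_ne_zero.2 ha0
    have hconj : Real.HolderConjugate (q + 1) ((q + 1) / q) := by
      rw [Real.holderConjugate_iff]
      refine ⟨by linarith, ?_⟩
      field_simp
      ring
    have hy := NNReal.young_inequality_real a κ hconj
    have h1 : a ^ (q + 1) ≤ C / Φ 1 * Φ a := by
      have h2 := hC a hapos a⁻¹ ((one_le_inv₀ hapos).2 ha)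
      rw [mul_inv_cancel₀ ha0, NNReal.inv_rpow] at h2
      have h3 : a ^ q ≤ C / Φ 1 * Φ a := by
        have : 0 < a ^ q := NNReal.rpow_pos hapos
        rw [div_mul_eq_mul_div, le_div_iff₀ hp]
        calc a ^ q * Φ 1 ≤ a ^ q * (C * (a ^ q)⁻¹ * Φ a) := by gcongr
          _ = C * Φ a := by field_simp
      refine le_trans ?_ h3
      exact NNReal.rpow_le_rpow_of_exponent_ge hapos ha (by linarith)
    refine hy.trans (add_le_add ?_ ?_)
    · refine (div_le_self zero_le ?_).trans (h1.trans ?_)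
      · rw [← NNReal.coe_le_coe, Real.coe_toNNReal _ (by linarith)]
        simp; linarith
      · gcongr
        exact le_max_right _ _
    · refine div_le_self zero_le ?_
      rw [← NNReal.coe_le_coe, Real.coe_toNNReal _ (by positivity)]
      rw [NNReal.coe_one, one_le_div hq0]
      linarith

/-- The kernel is only `O(1 / (1 + |t|))`, so Young's inequality splits the product. The kernel then
appears with power `(q + 1) / q`, which exceeds one even for `q = 1` and is therefore integrable. -/
lemma MemClassUq.integrable_cauchy {q : ℝ} (hq : 1 ≤ q) (h : MemClassUq q Φ) {f : ℝ → ℂ}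
    (hfm : Measurable f) {c : ℝ≥0} (hc : 0 < c)
    (hmod : ∫⁻ x : ℝ, (Φ (‖f x‖₊ / c) : ℝ≥0∞) ≤ 1) {w : ℂ} (hw : w.im ≠ 0) :
    Integrable (fun t : ℝ => f t / ((t : ℂ) - w)) := by
  have hq0 : 0 < q := by linarith
  have hd : 0 < |w.im| := abs_pos.2 hw
  set A : ℝ≥0 := (1 + (‖w‖ + 1) / |w.im|).toNNReal with hA
  have hAr : (A : ℝ) = 1 + (‖w‖ + 1) / |w.im| := Real.coe_toNNReal _ (by positivity)
  set κ : ℝ → ℝ≥0 := fun t => A * (1 + ‖t‖₊)⁻¹ with hκ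
  have hbound : ∀ t : ℝ, ‖((t : ℂ) - w)⁻¹‖₊ ≤ κ t := by
    intro t
    have h1 := norm_add_one_le_mul_norm_sub hd (abs_im_le_norm_sub t w)
    have h2 : 0 < ‖(t : ℂ) - w‖ := norm_pos_iff.2 (ofReal_sub_ne_zero hw t)
    rw [← NNReal.coe_le_coe, hκ]
    push_cast
    rw [hAr, norm_inv, ← div_eq_mul_inv, le_div_iff₀ (by positivity), ← div_eq_inv_mul,
      div_le_iff₀ h2]
    rw [Complex.norm_real] at h1
    linarith
  obtain ⟨D, hD⟩ := h.young hq A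
  have hκA : ∀ t, κ t ≤ A := fun t => by
    refine mul_le_of_le_one_right' (inv_le_one_of_one_le₀ ?_)
    exact le_add_of_nonneg_right zero_le
  have hpt : ∀ t : ℝ, ‖f t / ((t : ℂ) - w)‖ₑ ≤
      c * (D * (Φ (‖f t‖₊ / c) : ℝ≥0∞) + ((κ t ^ ((q + 1) / q) : ℝ≥0) : ℝ≥0∞)) := by
    intro t
    have h1 := hD (‖f t‖₊ / c) (κ t) (hκA t)
    have h2 : ‖f t / ((t : ℂ) - w)‖₊ ≤ c * (D * Φ (‖f t‖₊ / c) + κ t ^ ((q + 1) / q)) := by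
      calc ‖f t / ((t : ℂ) - w)‖₊ = ‖f t‖₊ * ‖((t : ℂ) - w)⁻¹‖₊ := by
            rw [div_eq_mul_inv, nnnorm_mul]
        _ ≤ ‖f t‖₊ * κ t := by gcongr; exact hbound t
        _ = c * (‖f t‖₊ / c * κ t) := by field_simp
        _ ≤ _ := by gcongr
    rw [enorm_eq_nnnorm]
    exact_mod_cast h2
  have hκint : ∫⁻ t : ℝ, ((κ t ^ ((q + 1) / q) : ℝ≥0) : ℝ≥0∞) ≠ ∞ := by
    have h1 : (Module.finrank ℝ ℝ : ℝ) < (q + 1) / q := by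
      rw [Module.finrank_self, Nat.cast_one, lt_div_iff₀ hq0]
      linarith
    have h2 := (integrable_one_add_norm (E := ℝ) (μ := volume) h1).const_mul
      ((A : ℝ) ^ ((q + 1) / q))
    refine ne_of_lt (lt_of_le_of_lt (le_of_eq (lintegral_congr fun t => ?_)) h2.2)
    rw [← ENNReal.ofReal_coe_nnreal, ← ofReal_norm, Real.norm_of_nonneg (by positivity)]
    congr 1
    rw [NNReal.coe_rpow, hκ]
    push_cast
    rw [Real.mul_rpow A.coe_nonneg (by positivity), Real.inv_rpow (by positivity),
      Real.rpow_neg (by positivity)]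
  refine ⟨(hfm.div (by fun_prop)).aestronglyMeasurable, ?_⟩
  refine lt_of_le_of_lt (lintegral_mono hpt) ?_
  have hΦm := h.growth.continuous.measurable
  rw [lintegral_const_mul' _ _ ENNReal.coe_ne_top, lintegral_add_left (by fun_prop),
    lintegral_const_mul' _ _ ENNReal.coe_ne_top]
  exact ENNReal.mul_lt_top ENNReal.coe_lt_top (ENNReal.add_lt_top.2
    ⟨ENNReal.mul_lt_top ENNReal.coe_lt_top (hmod.trans_lt ENNReal.one_lt_top),
      lt_top_iff_ne_top.2 hκint⟩)

/-- Vanishing of the second-order Cauchy integrals implies that of the Cauchy integral. -/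
lemma integral_cauchy_eq_zero {f : ℝ → ℂ}
    (hint : ∀ w : ℂ, w.im < 0 → Integrable (fun t : ℝ => f t / ((t : ℂ) - w)))
    (h2 : ∀ w w' : ℂ, w.im < 0 → w'.im < 0 →
      ∫ t : ℝ, f t * (1 / (((t : ℂ) - w) * ((t : ℂ) - w'))) = 0) {w : ℂ} (hw : w.im < 0) :
    ∫ t : ℝ, f t / ((t : ℂ) - w) = 0 := by
  set v : ℕ → ℂ := fun n => -((n : ℂ) + 1) * Complex.I with hv
  have hvim : ∀ n, (v n).im = -((n : ℝ) + 1) := fun n => by simp [hv]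
  have hvre : ∀ n, (v n).re = 0 := fun n => by simp [hv]
  have hvneg : ∀ n, (v n).im < 0 := fun n => by
    rw [hvim]; linarith [(Nat.cast_nonneg n : (0 : ℝ) ≤ n)]
  -- A difference of two Cauchy kernels is a multiple of their product, so `h2` makes the Cauchy
  -- integral independent of its pole. Moving the pole along `-(n + 1)i` to infinity shows that the
  -- common value is zero.
  have heq : ∀ n, ∫ t : ℝ, f t / ((t : ℂ) - v n) = ∫ t : ℝ, f t / ((t : ℂ) - w) := by
    intro n
    rw [← sub_eq_zero, ← integral_sub (hint _ (hvneg n)) (hint _ hw)]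
    have : ∀ t : ℝ, f t / ((t : ℂ) - v n) - f t / ((t : ℂ) - w) =
        (v n - w) * (f t * (1 / (((t : ℂ) - v n) * ((t : ℂ) - w)))) := by
      intro t
      have h1 := ofReal_sub_ne_zero (hvneg n).ne t
      have h3 := ofReal_sub_ne_zero hw.ne t
      field_simp
      ring
    simp_rw [this]
    rw [integral_const_mul, h2 _ _ (hvneg n) hw, mul_zero]
  have hnorm : ∀ (n : ℕ) (t : ℝ), ‖(t : ℂ) - v n‖ = Real.sqrt (t ^ 2 + ((n : ℝ) + 1) ^ 2) := by
    intro n t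
    rw [Complex.norm_def, Complex.normSq_apply]
    congr 1
    simp only [Complex.sub_re, Complex.sub_im, Complex.ofReal_re, Complex.ofReal_im, hvre, hvim]
    ring
  have hlim : Tendsto (fun n => ∫ t : ℝ, f t / ((t : ℂ) - v n)) atTop (𝓝 (∫ t : ℝ, (0 : ℂ))) := by
    refine tendsto_integral_of_dominated_convergence (fun t => ‖f t / ((t : ℂ) - v 0)‖)
      (fun n => (hint _ (hvneg n)).aestronglyMeasurable) (hint _ (hvneg 0)).norm
      (fun n => ae_of_all _ fun t => ?_) (ae_of_all _ fun t => ?_)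
    · rw [norm_div, norm_div]
      have h0 : 0 < ‖(t : ℂ) - v 0‖ := norm_pos_iff.2 (ofReal_sub_ne_zero (hvneg 0).ne t)
      refine div_le_div_of_nonneg_left (norm_nonneg _) h0 ?_
      rw [hnorm, hnorm]
      refine Real.sqrt_le_sqrt ?_
      push_cast
      nlinarith [(Nat.cast_nonneg n : (0 : ℝ) ≤ n)]
    · rw [tendsto_zero_iff_norm_tendsto_zero]
      have h1 : Tendsto (fun n : ℕ => ‖f t‖ * (1 / ((n : ℝ) + 1))) atTop (𝓝 (‖f t‖ * 0)) :=
        tendsto_one_div_add_atTop_nhds_zero_nat.const_mul _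
      rw [mul_zero] at h1
      refine squeeze_zero (fun n => norm_nonneg _) (fun n => ?_) h1
      rw [norm_div, div_eq_mul_one_div]
      gcongr
      have := abs_im_le_norm_sub t (v n)
      rw [hvim, abs_neg, abs_of_nonneg (by positivity)] at this
      exact this
  simp_rw [heq] at hlim
  rw [integral_zero] at hlim
  exact tendsto_nhds_unique tendsto_const_nhds hlim

/-! ### The Luxemburg norm and Poisson averages. -/

lemma luxNorm_congr_ae {f g : ℝ → ℂ} (h : f =ᵐ[volume] g) : luxNorm Φ f = luxNorm Φ g := by
  have : ∀ c : ℝ≥0, ∫⁻ x : ℝ, (Φ (‖f x‖₊ / c) : ℝ≥0∞) = ∫⁻ x : ℝ, (Φ (‖g x‖₊ / c) : ℝ≥0∞) :=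
    fun c => lintegral_congr_ae (by filter_upwards [h] with x hx; rw [hx])
  simp only [luxNorm, this]

lemma le_add_of_forall_lt_nnreal {a b s : ℝ≥0∞}
    (h : ∀ c d : ℝ≥0, a < c → b < d → s ≤ c + d) : s ≤ a + b := by
  rcases eq_or_ne a ∞ with rfl | ha
  · simp
  rcases eq_or_ne b ∞ with rfl | hb
  · simp
  refine ENNReal.le_of_forall_pos_le_add fun ε hε _ => ?_
  have hε2 : 0 < ε / 2 := half_pos hε
  lift a to ℝ≥0 using ha
  lift b to ℝ≥0 using hb
  refine (h (a + ε / 2) (b + ε / 2) (by exact_mod_cast lt_add_of_pos_right a hε2)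
    (by exact_mod_cast lt_add_of_pos_right b hε2)).trans (le_of_eq ?_)
  norm_cast
  rw [add_add_add_comm, add_halves]

/-- `(f + g) / (c + d)` is the convex combination of `f / c` and `g / d` with weights `c / (c + d)`
and `d / (c + d)`. -/
lemma luxNorm_add_le (hconv : ConvexOn ℝ≥0 Set.univ Φ) (hcont : Continuous Φ) (hm : Monotone Φ)
    {f g : ℝ → ℂ} (hf : Measurable f) :
    luxNorm Φ (fun x => f x + g x) ≤ luxNorm Φ f + luxNorm Φ g := by
  refine le_add_of_forall_lt_nnreal fun c d hc hd => ?_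
  have hc0 : 0 < c := by exact_mod_cast (zero_le : 0 ≤ luxNorm Φ f).trans_lt hc
  have hd0 : 0 < d := by exact_mod_cast (zero_le : 0 ≤ luxNorm Φ g).trans_lt hd
  have hcd : 0 < c + d := add_pos hc0 hd0
  have hsum : c / (c + d) + d / (c + d) = 1 := by rw [← add_div, div_self hcd.ne']
  rw [← ENNReal.coe_add]
  refine luxNorm_le hcd ?_
  have hpt : ∀ x, (Φ (‖f x + g x‖₊ / (c + d)) : ℝ≥0∞) ≤
      (c / (c + d) : ℝ≥0) * Φ (‖f x‖₊ / c) + (d / (c + d) : ℝ≥0) * Φ (‖g x‖₊ / d) := by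
    intro x
    have h1 := hconv.2 (Set.mem_univ (‖f x‖₊ / c)) (Set.mem_univ (‖g x‖₊ / d))
      (zero_le : 0 ≤ c / (c + d)) (zero_le : 0 ≤ d / (c + d)) hsum
    simp only [smul_eq_mul] at h1
    have h2 : ‖f x + g x‖₊ / (c + d) ≤
        c / (c + d) * (‖f x‖₊ / c) + d / (c + d) * (‖g x‖₊ / d) := by
      have : c / (c + d) * (‖f x‖₊ / c) + d / (c + d) * (‖g x‖₊ / d) =
          (‖f x‖₊ + ‖g x‖₊) / (c + d) := by field_simp
      rw [this]
      gcongr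
      exact nnnorm_add_le _ _
    exact_mod_cast (hm h2).trans h1
  have hΦm := hcont.measurable
  refine (lintegral_mono hpt).trans ?_
  rw [lintegral_add_left (by fun_prop), lintegral_const_mul' _ _ ENNReal.coe_ne_top,
    lintegral_const_mul' _ _ ENNReal.coe_ne_top]
  calc _ ≤ ((c / (c + d) : ℝ≥0) : ℝ≥0∞) * 1 + ((d / (c + d) : ℝ≥0) : ℝ≥0∞) * 1 := by
        gcongr
        · exact exists_modular_le_of_luxNorm_lt hm hc
        · exact exists_modular_le_of_luxNorm_lt hm hd
    _ = 1 := by rw [mul_one, mul_one, ← ENNReal.coe_add, hsum, ENNReal.coe_one]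

lemma luxNorm_poissonAvg_le (hconv : ConvexOn ℝ≥0 Set.univ Φ) (hcont : Continuous Φ)
    (hm : Monotone Φ) {f : ℝ → ℂ} (hfm : Measurable f) (hfi : Integrable f stdCauchy) {y : ℝ}
    (hy : 0 < y) : luxNorm Φ (poissonAvg f y) ≤ luxNorm Φ f := by
  have hΦm := hcont.measurable
  conv_rhs => rw [luxNorm]
  refine le_iInf₂ fun c hc => le_iInf fun hmod => luxNorm_le hc ?_
  calc ∫⁻ x : ℝ, (Φ (‖poissonAvg f y x‖₊ / c) : ℝ≥0∞)
      ≤ ∫⁻ x, ∫⁻ s, (Φ (c⁻¹ * ‖f (x + y * s)‖₊) : ℝ≥0∞) ∂stdCauchy := by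
        refine lintegral_mono fun x => ?_
        rw [div_eq_inv_mul]
        exact modular_integral_le hconv hcont hm (integrable_comp_affine hfi x hy) c⁻¹
    _ = ∫⁻ x, (Φ (c⁻¹ * ‖f x‖₊) : ℝ≥0∞) :=
        lintegral_lintegral_translate (h := fun x => (Φ (c⁻¹ * ‖f x‖₊) : ℝ≥0∞)) (by fun_prop) y
    _ ≤ 1 := by simpa only [div_eq_inv_mul] using hmod

lemma exists_modular_of_luxNorm_lt_top (hm : Monotone Φ) {f : ℝ → ℂ} (h : luxNorm Φ f < ∞) :
    ∃ c : ℝ≥0, 0 < c ∧ ∫⁻ x : ℝ, (Φ (‖f x‖₊ / c) : ℝ≥0∞) ≤ 1 := by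
  refine ⟨(luxNorm Φ f).toNNReal + 1, by positivity, exists_modular_le_of_luxNorm_lt hm ?_⟩
  rw [ENNReal.coe_add, ENNReal.coe_toNNReal h.ne]
  exact ENNReal.lt_add_right h.ne one_ne_zero

lemma MemClassUq.integrable_stdCauchy {q : ℝ} (h : MemClassUq q Φ) {f : ℝ → ℂ}
    (hfm : Measurable f) (hf : luxNorm Φ f < ∞) : Integrable f stdCauchy := by
  obtain ⟨c, hc, hmod⟩ := exists_modular_of_luxNorm_lt_top h.growth.monotone hf
  refine ⟨hfm.aestronglyMeasurable, ?_⟩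
  refine lt_of_le_of_lt (h.lintegral_enorm_le hfm hc
    ((lintegral_mono' stdCauchy_le le_rfl).trans hmod)) ?_
  rw [measure_univ]
  refine ENNReal.mul_lt_top ENNReal.coe_lt_top (ENNReal.add_lt_top.2 ⟨ENNReal.one_lt_top, ?_⟩)
  simpa using h.pos one_pos

/-- Once the modular of the difference dilated by `δ⁻¹` is at most one, its norm is at most `δ`;
this is why modular convergence is needed at every dilation. -/
lemma MemClassUq.tendsto_luxNorm_poissonAvg_sub {q : ℝ} (h : MemClassUq q Φ)
    (hconv : ConvexOn ℝ≥0 Set.univ Φ) {f : ℝ → ℂ} (hfm : Measurable f)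
    (hf : luxNorm Φ f < ∞) :
    Tendsto (fun y => luxNorm Φ (fun x => poissonAvg f y x - f x)) (𝓝[>] 0) (𝓝 0) := by
  obtain ⟨c, hc, hmod⟩ := exists_modular_of_luxNorm_lt_top h.growth.monotone hf
  have hconvg := tendsto_modular_poissonAvg_sub (ν := volume) le_rfl (A := 1) (by simp)
    (fun y _ _ g hg => by rw [lintegral_lintegral_translate hg, one_mul]) hconv
    h.growth.continuous h.growth.monotone h.growth.map_zero hfm (h.integrable_stdCauchy hfm hf)
    (fun K => h.modular_ne_top hc hmod K)
  rw [ENNReal.tendsto_nhds_zero]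
  intro ε hε
  obtain ⟨δ, hδ, hδε⟩ := ENNReal.lt_iff_exists_nnreal_btwn.1 hε
  have hδ0 : 0 < δ := by exact_mod_cast hδ
  filter_upwards [ENNReal.tendsto_nhds_zero.1 (hconvg δ⁻¹) 1 one_pos] with y hy
  refine (luxNorm_le hδ0 ?_).trans hδε.le
  simpa only [div_eq_inv_mul] using hy

/-- Both functions are limits of the same averages in `L¹` of the Cauchy distribution, which has the
Lebesgue null sets. -/
lemma ae_eq_of_poissonAvg_eq {f g : ℝ → ℂ} (hfm : Measurable f) (hgm : Measurable g)
    (hf : Integrable f stdCauchy) (hg : Integrable g stdCauchy)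
    (h : ∀ y : ℝ, 0 < y → ∀ x, poissonAvg f y x = poissonAvg g y x) : f =ᵐ[volume] g := by
  have h1 := (tendsto_lintegral_enorm_poissonAvg_sub hfm hf).add
    (tendsto_lintegral_enorm_poissonAvg_sub hgm hg)
  rw [add_zero] at h1
  have h0 : ∫⁻ x, ‖f x - g x‖ₑ ∂stdCauchy = 0 := by
    refine le_antisymm (ge_of_tendsto h1 ?_) zero_le
    filter_upwards [self_mem_nhdsWithin] with y hy
    have := (stronglyMeasurable_poissonAvg hfm y).measurable
    rw [← lintegral_add_left (by fun_prop)]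
    refine lintegral_mono fun x => ?_
    rw [h y hy x, add_comm, ← enorm_neg (poissonAvg g y x - f x)]
    refine le_trans (le_of_eq ?_) (enorm_add_le _ _)
    congr 1
    ring
  rw [lintegral_eq_zero_iff (by fun_prop)] at h0
  filter_upwards [ac_stdCauchy.ae_le h0] with x hx
  simpa [sub_eq_zero] using hx

/-- The forward implication: boundary functions of members of `H^Φ`. -/
theorem MemClassUq.exists_realHardy {q : ℝ} (hq : 1 ≤ q) (h : MemClassUq q Φ) {F : ℂ → ℂ}
    (hF : AnalyticOnNhd ℂ F upperHalf) (hnorm : hardyNorm Φ F < ∞) :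
    ∃ f ∈ realHardy Φ, IsPoissonIntegral F f := by
  obtain ⟨c, hc, hmod⟩ := exists_modular_slice_le h.growth.monotone hnorm
  obtain ⟨B, hB⟩ := h.exists_lintegral_slice_le hF hc hmod
  obtain ⟨f, hfm, hfi, hP, h2⟩ := exists_poisson_representation hF
    (fun y₀ hy₀ => h.exists_norm_le hF hc hmod hy₀) hB
  have hfmod := modular_le_of_poissonAvg h.growth.continuous hfm hfi (c := c) fun y hy => by
    simpa only [hP y hy] using hmod y hy
  have hae := AEEqFun.coeFn_mk f hfm.aestronglyMeasurable (μ := volume)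
  refine ⟨AEEqFun.mk f hfm.aestronglyMeasurable, ⟨?_, fun z hz => ?_⟩, fun z hz => ?_⟩
  · change luxNorm Φ _ < ∞
    rw [luxNorm_congr_ae hae]
    exact (luxNorm_le hc hfmod).trans_lt ENNReal.coe_lt_top
  · have hint : ∀ w : ℂ, w.im < 0 → Integrable (fun t : ℝ => f t / ((t : ℂ) - w)) :=
      fun w hw => h.integrable_cauchy hq hfm hc hfmod hw.ne
    have hzim : ((starRingEnd ℂ) z).im < 0 := by
      rw [Complex.conj_im]; exact neg_neg_of_pos hz
    have hae2 : (fun t : ℝ => (AEEqFun.mk f hfm.aestronglyMeasurable : ℝ →ₘ[volume] ℂ) t /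
        ((t : ℂ) - (starRingEnd ℂ) z)) =ᵐ[volume]
        fun t : ℝ => f t / ((t : ℂ) - (starRingEnd ℂ) z) := by
      filter_upwards [hae] with t ht
      rw [ht]
    exact ⟨(hint _ hzim).congr hae2.symm, (integral_congr_ae hae2).trans
      (integral_cauchy_eq_zero hint h2 hzim)⟩
  · rw [isPoissonIntegral_iff.2 hP z hz]
    congr 1
    refine integral_congr_ae ?_
    filter_upwards [hae] with t ht
    rw [poissonIntegrand, poissonIntegrand, ht]

/-! ### Kernel identities and the proof of the theorem. -/

lemma ofReal_sq_add_sq_eq_mul (z : ℂ) (t : ℝ) : (((z.re - t) ^ 2 + z.im ^ 2 : ℝ) : ℂ) =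
    ((t : ℂ) - z) * (t - (starRingEnd ℂ) z) := by
  apply Complex.ext
  · rw [Complex.ofReal_re]
    simp
    ring
  · rw [Complex.ofReal_im]
    simp
    ring

/-- Partial fractions with poles `z` and `z̄`. For members of `realHardy` the `z̄` term integrates
to zero, so Poisson and Cauchy integrals agree up to a constant. -/
lemma poissonIntegrand_eq (f : ℝ → ℂ) {z : ℂ} (hz : 0 < z.im) (t : ℝ) :
    poissonIntegrand f z t = (1 / (2 * Complex.I)) *
      (cauchyIntegrand f z t - f t / ((t : ℂ) - (starRingEnd ℂ) z)) := by
  have h1 : (t : ℂ) - z ≠ 0 := ofReal_sub_ne_zero hz.ne' t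
  have h2 : (t : ℂ) - (starRingEnd ℂ) z ≠ 0 :=
    ofReal_sub_ne_zero (by rw [Complex.conj_im]; exact neg_ne_zero.2 hz.ne') t
  have h4 : z - (starRingEnd ℂ) z = 2 * Complex.I * z.im := by
    apply Complex.ext <;> simp; ring
  rw [poissonIntegrand, cauchyIntegrand, Complex.ofReal_div, ofReal_sq_add_sq_eq_mul]
  field_simp
  linear_combination (-f t) * h4

lemma conjPoissonIntegrand_eq (f : ℝ → ℂ) {z : ℂ} (hz : 0 < z.im) (t : ℝ) :
    conjPoissonIntegrand f z t = (-1 / 2) *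
      (cauchyIntegrand f z t + f t / ((t : ℂ) - (starRingEnd ℂ) z)) := by
  have h1 : (t : ℂ) - z ≠ 0 := ofReal_sub_ne_zero hz.ne' t
  have h2 : (t : ℂ) - (starRingEnd ℂ) z ≠ 0 :=
    ofReal_sub_ne_zero (by rw [Complex.conj_im]; exact neg_ne_zero.2 hz.ne') t
  have h4 : z + (starRingEnd ℂ) z = 2 * z.re := by
    apply Complex.ext <;> simp; ring
  rw [conjPoissonIntegrand, cauchyIntegrand, Complex.ofReal_div, ofReal_sq_add_sq_eq_mul]
  push_cast
  field_simp
  linear_combination (-f t) * h4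

end HardyOrlicz

open HardyOrlicz in
theorem mainTheorem3 (Φ : ℝ≥0 → ℝ≥0) (hΦ : HardyOrlicz.MemClassU Φ)
    (hconv : ConvexOn ℝ≥0 Set.univ Φ)
    (F : ℂ → ℂ) (hF : AnalyticOnNhd ℂ F HardyOrlicz.upperHalf) :
    (F ∈ HardyOrlicz.analyticHardy Φ ↔
      ∃ f ∈ HardyOrlicz.realHardy Φ, HardyOrlicz.IsPoissonIntegral F f) ∧
    (∀ f ∈ HardyOrlicz.realHardy Φ, HardyOrlicz.IsPoissonIntegral F f →
      (∀ g ∈ HardyOrlicz.realHardy Φ, HardyOrlicz.IsPoissonIntegral F g → g = f) ∧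
      (∀ z ∈ HardyOrlicz.upperHalf,
        Integrable (HardyOrlicz.poissonIntegrand f z) ∧
        Integrable (HardyOrlicz.conjPoissonIntegrand f z) ∧
        Integrable (HardyOrlicz.cauchyIntegrand f z) ∧
        F z = (Complex.I / (Real.pi : ℂ)) * ∫ t : ℝ, HardyOrlicz.conjPoissonIntegrand f z t ∧
        F z = (1 / (2 * (Real.pi : ℂ) * Complex.I)) *
          ∫ t : ℝ, HardyOrlicz.cauchyIntegrand f z t) ∧
      Tendsto (fun y : ℝ => HardyOrlicz.luxNorm Φ (fun x => HardyOrlicz.slice F y x - f x))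
        (𝓝[>] 0) (𝓝 0) ∧
      Tendsto (fun y : ℝ => HardyOrlicz.luxNorm Φ (HardyOrlicz.slice F y))
        (𝓝[>] 0) (𝓝 (HardyOrlicz.hardyNorm Φ F)) ∧
      HardyOrlicz.hardyNorm Φ F = HardyOrlicz.luxNorm Φ f) := by
  obtain ⟨q, hq, h⟩ := hΦ
  have hcont := h.growth.continuous
  have hmono := h.growth.monotone
  have hle : ∀ f ∈ realHardy Φ, IsPoissonIntegral F f → ∀ y : ℝ, 0 < y →
      luxNorm Φ (slice F y) ≤ luxNorm Φ f := by
    intro f hf hP y hy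
    rw [show slice F y = poissonAvg f y from funext (isPoissonIntegral_iff.1 hP y hy)]
    exact luxNorm_poissonAvg_le hconv hcont hmono f.stronglyMeasurable.measurable
      (h.integrable_stdCauchy f.stronglyMeasurable.measurable hf.1) hy
  refine ⟨⟨fun hFH => h.exists_realHardy hq hF hFH.1.2, ?_⟩, ?_⟩
  · rintro ⟨f, hf, hP⟩
    refine ⟨⟨fun z hz => (hF z hz).harmonicAt, ?_⟩, hF⟩
    exact (iSup₂_le fun y hy => hle f hf hP y hy).trans_lt hf.1
  · intro f hf hP
    have hfm : Measurable f := f.stronglyMeasurable.measurable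
    have hfi := h.integrable_stdCauchy hfm hf.1
    have hslice := isPoissonIntegral_iff.1 hP
    have hlim : Tendsto (fun y : ℝ => luxNorm Φ (fun x => slice F y x - f x)) (𝓝[>] 0) (𝓝 0) := by
      refine (h.tendsto_luxNorm_poissonAvg_sub hconv hfm hf.1).congr' ?_
      filter_upwards [self_mem_nhdsWithin] with y hy
      simp only [hslice y hy]
    have hnormlim : Tendsto (fun y : ℝ => luxNorm Φ (slice F y)) (𝓝[>] 0)
        (𝓝 (luxNorm Φ f)) := by
      -- The reverse triangle inequality gives this lower bound and contractivity the upper one.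
      -- Finiteness of the norm of `f` makes the truncated subtraction continuous here.
      have hlow : Tendsto (fun y : ℝ => luxNorm Φ f - luxNorm Φ (fun x => slice F y x - f x))
          (𝓝[>] 0) (𝓝 (luxNorm Φ f)) := by
        simpa using ENNReal.Tendsto.sub tendsto_const_nhds hlim (Or.inl hf.1.ne)
      refine tendsto_of_tendsto_of_tendsto_of_le_of_le' hlow tendsto_const_nhds ?_ ?_
      · filter_upwards [self_mem_nhdsWithin] with y hy
        rw [tsub_le_iff_right]
        have h1 := luxNorm_add_le hconv hcont hmono (f := slice F y)
          (g := fun x => -(slice F y x - f x)) (slice_continuous hF hy).measurable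
        have h2 : luxNorm Φ (fun x => -(slice F y x - f x)) =
            luxNorm Φ (fun x => slice F y x - f x) := by
          simp only [luxNorm, nnnorm_neg]
        rw [h2] at h1
        simpa using h1
      · filter_upwards [self_mem_nhdsWithin] with y hy
        exact hle f hf hP y hy
    have hnorm : hardyNorm Φ F = luxNorm Φ f := by
      refine le_antisymm (iSup₂_le fun y hy => hle f hf hP y hy) (le_of_tendsto hnormlim ?_)
      filter_upwards [self_mem_nhdsWithin] with y hy
      exact luxNorm_le_hardyNorm F hy
    refine ⟨fun g hg hPg => ?_, fun z hz => ?_, hlim, hnorm ▸ hnormlim, hnorm⟩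
    · have hgm : Measurable g := g.stronglyMeasurable.measurable
      refine AEEqFun.ext (ae_eq_of_poissonAvg_eq hgm hfm (h.integrable_stdCauchy hgm hg.1) hfi
        fun y hy x => ?_)
      rw [← hslice y hy, ← isPoissonIntegral_iff.1 hPg y hy]
    · obtain ⟨c, hc, hmod⟩ := exists_modular_of_luxNorm_lt_top hmono hf.1
      have hzpos : 0 < z.im := hz
      have hC : Integrable (cauchyIntegrand f z) :=
        h.integrable_cauchy hq hfm hc hmod hzpos.ne'
      obtain ⟨hC', hC0⟩ := hf.2 z hz
      have e1 : poissonIntegrand f z = fun t => (1 / (2 * Complex.I)) *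
          (cauchyIntegrand f z t - f t / ((t : ℂ) - (starRingEnd ℂ) z)) :=
        funext fun t => poissonIntegrand_eq f hzpos t
      have e2 : conjPoissonIntegrand f z = fun t => (-1 / 2) *
          (cauchyIntegrand f z t + f t / ((t : ℂ) - (starRingEnd ℂ) z)) :=
        funext fun t => conjPoissonIntegrand_eq f hzpos t
      have i1 : F z = (1 / (2 * (Real.pi : ℂ) * Complex.I)) * ∫ t : ℝ, cauchyIntegrand f z t := by
        rw [hP z hz, e1, integral_const_mul, integral_sub hC hC', hC0, sub_zero, ← mul_assoc]
        congr 1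
        rw [div_mul_div_comm]
        congr 1
        · ring
        · ring
      refine ⟨?_, ?_, hC, ?_, i1⟩
      · rw [e1]
        exact (hC.sub hC').const_mul _
      · rw [e2]
        exact (hC.add hC').const_mul _
      · rw [i1, e2, integral_const_mul, integral_add hC hC', hC0, add_zero, ← mul_assoc]
        congr 1
        have hpi : (Real.pi : ℂ) ≠ 0 := by exact_mod_cast Real.pi_ne_zero
        field_simp
        rw [Complex.I_sq]
        ring
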